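/- Let $(M,g)$ be a smooth four-dimensional spacetime of signature $(+,-,-,-)$ with Levi-Civita connection $\nabla$, let $v$ be a smooth function on $M$ whose level sets $\Sigma_s=\{v=s\}$ are null hypersurfaces foliating $M$, and let $D$ be a nowhere vanishing smooth null vector field tangent to the null generators of the $\Sigma_s$ (so $D^\perp=\ker dv$). At each point complete $D$ to a null tetrad $\{D,D',\delta,\delta'=\bar\delta\}$ with $g(D,D')=-g(\delta,\delta')=\chi\bar\chi>0$ and all other products zero, and put $$\rho=\frac{g(\nabla_{\delta'}D,\delta)}{\chi\bar\chi},\qquad \sigma=\frac{g(\nabla_{\delta}D,\delta)}{\chi\bar\chi},\qquad \epsilon+\bar\epsilon=\frac{g(\nabla_DD,D')}{\chi\bar\chi},\qquad \Phi_{00}=\tfrac12\mathrm{Ric}(D,D)$$ ($\rho$, the contracting rate, is real, and $\rho$, $|\sigma|^2$, $\epsilon+\bar\epsilon$, $\Phi_{00}$ depend only on $D$). Let $\Sigma=\Sigma_c$ be one of these null hypersurfaces and $S_0\subset\Sigma$ a non-empty compact embedded spatial two-surface without boundary on which $\rho=\rho_0>0$ ($\rho_0$ a function on $S_0$). Let $\varepsilon>0$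 be a constant. For $p\in S_0$ suppose that the integral curve $u\mapsto\gamma_p(u)$ of $D$ with $\gamma_p(0)=p$ is defined for $0\le u\le\rho_0(p)/\varepsilon$, and that along these curves $D$ is in the boost gauge $\rho+\epsilon+\bar\epsilon=0$ (in which the focusing equation $D\rho=(\epsilon+\bar\epsilon)\rho+\rho^2+\sigma\bar\sigma+\Phi_{00}$ becomes $\partial_u\rho=\sigma\bar\sigma+\Phi_{00}$). If $$\Phi_{00}\le-(|\sigma|^2+\varepsilon)\qquad\text{at }\gamma_p(u)\text{ for all }p\in S_0,\ 0<u<\rho_0(p)/\varepsilon,$$ then on every generator $\gamma_p$ the rate $\rho$ vanishes at some $u\in(0,\rho_0(p)/\varepsilon]$, and a trapping horizon exists: for some $\eta>0$ there is a smooth one-parameter family $\{H_s\}_{|s-c|<\eta}$ of non-empty compact embedded spatial two-surfaces $H_s\subset\Sigma_s$, sweeping out an embedded hypersurface on which $v$ has no critical point, such that $\rho=0$ on every $H_s$, computed in null tetrads whose $\delta,\delta'$ span $H_s$. Moreover $H_c\subset\Sigma$ consists of points $\gamma_p(u)$ with $p\in S_0$, $0<u\le\rho_0(p)/\varepsilon$,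 and for each $p\in S_0$ there is exactly one $u\in[0,\rho_0(p)/\varepsilon]$ with $\gamma_p(u)\in H_c$. -/

import Mathlib

open scoped Manifold ContDiff Topology Bundle

noncomputable section

namespace NullGeom

/-- The model space of four-dimensional manifolds. -/
abbrev E4 : Type := EuclideanSpace ℝ (Fin 4)

variable {M : Type*} [TopologicalSpace M] [ChartedSpace E4 M] [IsManifold (𝓡 4) ∞ M]

/-- A smooth Lorentzian metric on a four-manifold, with signature `(+,-,-,-)`. -/
structure LorentzMetric (M : Type*) [TopologicalSpace M] [ChartedSpace E4 M]
    [IsManifold (𝓡 4) ∞ M] where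
  /-- The bilinear form on each tangent space. -/
  form (x : M) : TangentSpace (𝓡 4) x →L[ℝ] TangentSpace (𝓡 4) x →L[ℝ] ℝ
  symm (x : M) (X Y : TangentSpace (𝓡 4) x) : form x X Y = form x Y X
  /-- There is a timelike vector whose orthogonal complement is negative definite. -/
  signature (x : M) : ∃ T : TangentSpace (𝓡 4) x, 0 < form x T T ∧
    ∀ X : TangentSpace (𝓡 4) x, X ≠ 0 → form x T X = 0 → form x X X < 0
  contMDiff : ContMDiff (𝓡 4) ((𝓡 4).prod 𝓘(ℝ, E4 →L[ℝ] E4 →L[ℝ] ℝ)) ∞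
    (fun x => Bundle.TotalSpace.mk' (E4 →L[ℝ] E4 →L[ℝ] ℝ) x (form x))

/-- A smooth vector field on `M`. -/
def IsSmoothField (X : Π x : M, TangentSpace (𝓡 4) x) : Prop :=
  ContMDiff (𝓡 4) (𝓡 4).tangent ∞ (fun x => (⟨x, X x⟩ : TangentBundle (𝓡 4) M))

/-- Differentiability of a vector field at a point. -/
def FieldDiffAt (X : Π x : M, TangentSpace (𝓡 4) x) (x : M) : Prop :=
  MDifferentiableAt (𝓡 4) (𝓡 4).tangent (fun x => (⟨x, X x⟩ : TangentBundle (𝓡 4) M)) x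

/-- Affine connections on `M`; `nabla Y x (X x)` is `(∇_X Y)(x)`. -/
abbrev Connection (M : Type*) [TopologicalSpace M] [ChartedSpace E4 M]
    [IsManifold (𝓡 4) ∞ M] : Type _ :=
  CovariantDerivative (𝓡 4) E4 (TangentSpace (𝓡 4) : M → Type _)

/-- `nabla` is the Levi-Civita connection of `g`: the smooth affine connection that is
torsion-free and compatible with `g`. -/
structure IsLeviCivita (g : LorentzMetric M) (nabla : Connection M) : Prop where
  smooth : nabla.ContMDiffCovariantDerivative ∞
  torsion_free : nabla.torsion = 0
  metric (Y Z : Π x : M, TangentSpace (𝓡 4) x) (x : M) (X : TangentSpace (𝓡 4) x) :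
    FieldDiffAt Y x → FieldDiffAt Z x →
    mfderiv (𝓡 4) 𝓘(ℝ, ℝ) (fun y => g.form y (Y y) (Z y)) x X
      = g.form x (nabla Y x X) (Z x) + g.form x (Y x) (nabla Z x X)

/-- The curvature `R(X,Y)Z = ∇_X ∇_Y Z - ∇_Y ∇_X Z - ∇_[X,Y] Z`, evaluated at `x`. -/
def curvature (nabla : Connection M) (X Y Z : Π x : M, TangentSpace (𝓡 4) x) (x : M) :
    TangentSpace (𝓡 4) x :=
  nabla (fun y => nabla Z y (Y y)) x (X x) - nabla (fun y => nabla Z y (X y)) x (Y x)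
    - nabla Z x (VectorField.mlieBracket (𝓡 4) X Y x)

instance (x : M) : FiniteDimensional ℝ (TangentSpace (𝓡 4) x) :=
  inferInstanceAs (FiniteDimensional ℝ E4)

/-- The Ricci curvature `Ric(Y,Z)` at `x`, the trace of `X ↦ R(X,Y)Z`. The vectors of a basis of
`T_x M` are extended to vector fields that are smooth near `x`. -/
def ricci (nabla : Connection M) (Y Z : Π x : M, TangentSpace (𝓡 4) x) (x : M) : ℝ :=
  let b := Module.finBasis ℝ (TangentSpace (𝓡 4) x)
  ∑ i, b.repr (curvature nabla (FiberBundle.extend E4 (b i)) Y Z x) i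

/-- The curvature component `Φ₀₀ = ½ Ric(D,D)`; the sign is the one for which the null energy
condition reads `Φ₀₀ ≥ 0`. -/
def Phi00 (nabla : Connection M) (D : Π x : M, TangentSpace (𝓡 4) x) (x : M) : ℝ :=
  ricci nabla D D x / 2

/-- The level sets of the smooth function `v` form a foliation by null hypersurfaces, and the smooth
vector field `D` is tangent to their null generators: `D` is nowhere zero and null, and `D^⊥` is
the tangent space of the leaf. (In particular `dv ≠ 0` everywhere.) -/
structure IsNullFoliation (g : LorentzMetric M) (v : M → ℝ)
    (D : Π x : M, TangentSpace (𝓡 4) x) : Prop where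
  smooth_v : ContMDiff (𝓡 4) 𝓘(ℝ, ℝ) ∞ v
  smooth_D : IsSmoothField D
  ne_zero (x : M) : D x ≠ 0
  isNull (x : M) : g.form x (D x) (D x) = 0
  normal (x : M) (X : TangentSpace (𝓡 4) x) :
    mfderiv (𝓡 4) 𝓘(ℝ, ℝ) v x X = 0 ↔ g.form x (D x) X = 0

/-- A null tetrad `{D, D', δ, δ'}` at `x` with first leg `D x`, where `δ = X + iY` and
`δ' = X - iY`; it is normalized by `g(D,D') = -g(δ,δ') = χχ̄` and all the other products vanish. -/
structure NullTetrad (g : LorentzMetric M) (D : Π x : M, TangentSpace (𝓡 4) x) (x : M) where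
  /-- The second real null vector `D'`. -/
  D' : TangentSpace (𝓡 4) x
  /-- The real part of `δ`. -/
  X : TangentSpace (𝓡 4) x
  /-- The imaginary part of `δ`. -/
  Y : TangentSpace (𝓡 4) x
  /-- The normalization `χχ̄`. -/
  chi2 : ℝ
  chi2_pos : 0 < chi2
  D_D : g.form x (D x) (D x) = 0
  D'_D' : g.form x D' D' = 0
  D_D' : g.form x (D x) D' = chi2
  D_X : g.form x (D x) X = 0
  D_Y : g.form x (D x) Y = 0
  D'_X : g.form x D' X = 0
  D'_Y : g.form x D' Y = 0
  /-- The real part of `g(δ,δ) = 0`. -/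
  X_X : g.form x X X = g.form x Y Y
  /-- The imaginary part of `g(δ,δ) = 0`. -/
  X_Y : g.form x X Y = 0
  /-- `g(δ,δ') = -χχ̄`. -/
  delta_delta' : g.form x X X + g.form x Y Y = -chi2

namespace NullTetrad

variable {g : LorentzMetric M} {D : Π x : M, TangentSpace (𝓡 4) x} {x : M}

/-- The spin coefficient `ρ`. From `∇_δ' D = (α + β̄) D - ρ δ' - σ̄ δ` it is
`ρ = g(∇_δ' D, δ) / χχ̄`, with `g` extended complex-bilinearly. -/
def rho (nabla : Connection M) (t : NullTetrad g D x) : ℂ :=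
  (⟨g.form x (nabla D x t.X) t.X + g.form x (nabla D x t.Y) t.Y,
    g.form x (nabla D x t.X) t.Y - g.form x (nabla D x t.Y) t.X⟩ : ℂ) / (t.chi2 : ℂ)

/-- The spin coefficient `σ`. From `∇_δ D = (β + ᾱ) D - σ δ' - ρ̄ δ` it is
`σ = g(∇_δ D, δ) / χχ̄`, with `g` extended complex-bilinearly. -/
def sigma (nabla : Connection M) (t : NullTetrad g D x) : ℂ :=
  (⟨g.form x (nabla D x t.X) t.X - g.form x (nabla D x t.Y) t.Y,
    g.form x (nabla D x t.X) t.Y + g.form x (nabla D x t.Y) t.X⟩ : ℂ) / (t.chi2 : ℂ)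

/-- The sum `ε + ε̄`. From `∇_D D = (ε + ε̄) D - κ δ' - κ̄ δ` it is `g(∇_D D, D') / χχ̄`. -/
def epsSum (nabla : Connection M) (t : NullTetrad g D x) : ℝ :=
  g.form x (nabla D x (D x)) t.D' / t.chi2

end NullTetrad

/-- `S` is an embedded smooth two-surface in the four-manifold `M`: locally it is the zero set of a
smooth map to `ℝ × ℝ` with surjective differential. -/
def IsSurface (S : Set M) : Prop :=
  ∀ x ∈ S, ∃ (U : Set M) (f : M → ℝ × ℝ), IsOpen U ∧ x ∈ U ∧
    ContMDiffOn (𝓡 4) 𝓘(ℝ, ℝ × ℝ) ∞ f U ∧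
    (∀ y ∈ U, y ∈ S ↔ f y = 0) ∧
    Function.Surjective (mfderiv (𝓡 4) 𝓘(ℝ, ℝ × ℝ) f x)

/-- `X` is tangent to the embedded submanifold `S` at `x`: it annihilates all smooth functions that
vanish on `S` near `x`. -/
def IsTangentTo (S : Set M) (x : M) (X : TangentSpace (𝓡 4) x) : Prop :=
  ∀ f : M → ℝ, ContMDiffAt (𝓡 4) 𝓘(ℝ, ℝ) ∞ f x → (∀ᶠ y in 𝓝 x, y ∈ S → f y = 0) →
    mfderiv (𝓡 4) 𝓘(ℝ, ℝ) f x X = 0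

/-- `S` is a spatial two-surface: embedded, and the (induced) metric is definite on its tangent
spaces, with the sign of spacelike vectors. -/
structure IsSpatialSurface (g : LorentzMetric M) (S : Set M) : Prop where
  surface : IsSurface S
  spatial (x : M) (hx : x ∈ S) (X : TangentSpace (𝓡 4) x) :
    IsTangentTo S x X → X ≠ 0 → g.form x X X < 0

/-- A trapping horizon, given as a family of spatial two-surfaces `H s`, where `s` runs through the
open interval `(a,b)`: `H s` lies in the null hypersurface `{v = s}` with generators `D`, the
contracting rate `ρ`, computed in null tetrads whose `δ, δ'` span `H s`, vanishes on it, and the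
surfaces depend smoothly on `s`: their union is an embedded hypersurface, on which `v` has no
critical point. -/
structure IsTrappingHorizon (g : LorentzMetric M) (nabla : Connection M) (v : M → ℝ)
    (D : Π x : M, TangentSpace (𝓡 4) x) (a b : ℝ) (H : ℝ → Set M) : Prop where
  nonempty (s : ℝ) (hs : s ∈ Set.Ioo a b) : (H s).Nonempty
  subset (s : ℝ) (hs : s ∈ Set.Ioo a b) : ∀ x ∈ H s, v x = s
  spatial (s : ℝ) (hs : s ∈ Set.Ioo a b) : IsSpatialSurface g (H s)
  rho_eq_zero (s : ℝ) (hs : s ∈ Set.Ioo a b) : ∀ x ∈ H s, ∃ t : NullTetrad g D x,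
    IsTangentTo (H s) x t.X ∧ IsTangentTo (H s) x t.Y ∧ t.rho nabla = 0
  smooth_family (s : ℝ) (hs : s ∈ Set.Ioo a b) : ∀ x ∈ H s, ∃ (U : Set M) (f : M → ℝ),
    IsOpen U ∧ x ∈ U ∧ ContMDiffOn (𝓡 4) 𝓘(ℝ, ℝ) ∞ f U ∧
    (∀ y ∈ U, y ∈ (⋃ r ∈ Set.Ioo a b, H r) ↔ f y = 0) ∧
    Function.Surjective (fun X : TangentSpace (𝓡 4) x =>
      ((mfderiv (𝓡 4) 𝓘(ℝ, ℝ) f x X : ℝ), (mfderiv (𝓡 4) 𝓘(ℝ, ℝ) v x X : ℝ)))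

end NullGeom

end

/-! The contracting rate of the leaves is a smooth real function `r` on `M`, whatever the tetrads:
symmetry of the shape operator of a null hypersurface makes ρ real, `∇_D D = (ε + ε̄) D` fixes `ε +
ε̄` without the tetrad, and `tr ∇D = (ε + ε̄) - 2ρ` then fixes ρ. Tracing the curvature of `D`, with
`tr (∇D)² = (ε + ε̄)² + 2ρ² + 2|σ|²`, gives the focusing equation (`focusing`). In the boost gauge
its terms in ρ cancel, and the energy condition leaves `Dr ≤ -ε` along the given curves. As `r`
starts at `ρ₀`, it has exactly one zero up to parameter `ρ₀/ε`.

Let `F` (`focalSet`) be the set of these zeros. It is compact, because the curves depend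
continuously on `p` and run over compact parameter intervals of bounded length. It is also
relatively open in `{r = 0, v = c}` (`eventually_mem_focalSet`): from a nearby zero in the leaf the
generator can be followed backwards to `S₀`, which it meets because a spatial surface in a null leaf
is transverse to `D`.

On `F` one has `Dr < 0`, `Dv = 0` and `dv ≠ 0`, so `(r, v)` is a submersion there. Compactness and
relative openness isolate `F` in an open set `N` on which the levels `{r = 0, v = s}` stay non-empty
and compact for `s` near `c` (`exists_levels`). These levels form the horizon
(`isTrappingHorizon_levels`): `dr(D) ≠ 0` keeps `D` out of their tangent planes, which are therefore
spatial, and a null rotation about `D` makes a tetrad tangent to them without changing ρ. -/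

noncomputable section

set_option linter.unusedSectionVars false

/-! ### Vector fields in charts and the Lie bracket as a commutator. -/

namespace NullGeom

variable {M : Type*} [TopologicalSpace M] [ChartedSpace E4 M] [IsManifold (𝓡 4) ∞ M]

/-- Vector fields that are smooth near `x`. -/
abbrev SmoothFieldAt (X : Π x : M, TangentSpace (𝓡 4) x) (x : M) : Prop :=
  ContMDiffAt (𝓡 4) (𝓡 4).tangent ∞ (fun x => (⟨x, X x⟩ : TangentBundle (𝓡 4) M)) x

/-- The derivative of the function `f` along the vector field `X`. -/
abbrev along (X : Π x : M, TangentSpace (𝓡 4) x) (f : M → ℝ) (x : M) : ℝ :=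
  mvfderiv (𝓡 4) f x (X x)

theorem SmoothFieldAt.fieldDiffAt {X : Π x : M, TangentSpace (𝓡 4) x} {x : M}
    (h : SmoothFieldAt X x) : FieldDiffAt X x :=
  ContMDiffAt.mdifferentiableAt h (by simp)

theorem LorentzMetric.contMDiffAt_form (g : LorentzMetric M) {Y Z : Π x : M, TangentSpace (𝓡 4) x}
    {x : M} (hY : SmoothFieldAt Y x) (hZ : SmoothFieldAt Z x) :
    ContMDiffAt (𝓡 4) 𝓘(ℝ, ℝ) ∞ (fun y => g.form y (Y y) (Z y)) x := by
  have h := ContMDiffAt.clm_bundle_apply₂ (F₁ := E4) (F₂ := E4) (F₃ := ℝ)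
    (E₁ := TangentSpace (𝓡 4)) (E₂ := TangentSpace (𝓡 4)) (E₃ := Bundle.Trivial M ℝ)
    (g.contMDiff x) hY hZ
  rw [Bundle.contMDiffAt_section] at h
  exact h

theorem contMDiffAt_along {Y : Π x : M, TangentSpace (𝓡 4) x} {f : M → ℝ}
    {x : M} (hf : ContMDiff (𝓡 4) 𝓘(ℝ, ℝ) ∞ f) (hY : SmoothFieldAt Y x) :
    ContMDiffAt (𝓡 4) 𝓘(ℝ, ℝ) ∞ (along Y f) x := by
  have h1 := hf.contMDiff_tangentMap (m := ∞) (by simp)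
  have h2 := (contMDiff_snd_tangentBundle_modelSpace ℝ 𝓘(ℝ, ℝ) (n := ∞)).comp h1
  exact (h2.contMDiffAt (x := (⟨x, Y x⟩ : TangentBundle (𝓡 4) M))).comp x hY

theorem along_congr {X : Π x : M, TangentSpace (𝓡 4) x} {f h : M → ℝ} {x : M}
    (e : f =ᶠ[𝓝 x] h) : along X f x = along X h x := by
  have h1 : mfderiv (𝓡 4) 𝓘(ℝ, ℝ) f x = mfderiv (𝓡 4) 𝓘(ℝ, ℝ) h x := e.mfderiv_eq
  change (mfderiv (𝓡 4) 𝓘(ℝ, ℝ) f x) (X x) = _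
  rw [h1]
  rfl

-- In the expansion of the two iterated derivatives the second derivatives of `F` cancel by
-- symmetry.
open VectorField in
theorem fderiv_lieBracket {F : E4 → ℝ} {V W : E4 → E4} {a : E4} (hF : ContDiffAt ℝ ∞ F a)
    (hV : DifferentiableAt ℝ V a) (hW : DifferentiableAt ℝ W a) :
    fderiv ℝ F a (lieBracket ℝ V W a) = fderiv ℝ (fun z => fderiv ℝ F z (W z)) a (V a)
      - fderiv ℝ (fun z => fderiv ℝ F z (V z)) a (W a) := by
  have hF' : DifferentiableAt ℝ (fderiv ℝ F) a :=
    (hF.fderiv_right (m := 1) (by norm_cast)).differentiableAt one_ne_zero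
  have hs := hF.isSymmSndFDerivAt (by simp; exact WithTop.coe_le_coe.2 le_top)
  rw [fderiv_clm_apply hF' hW, fderiv_clm_apply hF' hV]
  simp only [lieBracket, map_sub, _root_.add_apply, ContinuousLinearMap.comp_apply,
    ContinuousLinearMap.flip_apply]
  rw [hs.eq (V a) (W a)]
  ring

/-- The representative of a vector field in the chart at `x`. -/
def chartField (x : M) (Z : Π x : M, TangentSpace (𝓡 4) x) : E4 → E4 :=
  VectorField.mpullbackWithin 𝓘(ℝ, E4) (𝓡 4) (extChartAt (𝓡 4) x).symm Z (Set.range (𝓡 4))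

/-- The pullback contains the inverse of the differential of the inverse chart, which the chain rule
cancels. Points `y` other than the centre are allowed, since the identity is to be differentiated
again. -/
theorem mvfderiv_eq_fderiv_chart {h : M → ℝ} {x y : M} (hy : y ∈ (extChartAt (𝓡 4) x).source)
    (hh : MDifferentiableAt (𝓡 4) 𝓘(ℝ, ℝ) h y) (Z : Π x : M, TangentSpace (𝓡 4) x) :
    along Z h y = fderiv ℝ (h ∘ (extChartAt (𝓡 4) x).symm) (extChartAt (𝓡 4) x y)
      (chartField x Z (extChartAt (𝓡 4) x y)) := by
  set φ := extChartAt (𝓡 4) x with hφ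
  have hyt : φ y ∈ φ.target := φ.map_source hy
  have hinv : φ.symm (φ y) = y := φ.left_inv hy
  have hS := isInvertible_mfderivWithin_extChartAt_symm (I := 𝓡 4) hyt
  have hd : MDifferentiableWithinAt 𝓘(ℝ, E4) (𝓡 4) φ.symm (Set.range (𝓡 4)) (φ y) :=
    mdifferentiableWithinAt_extChartAt_symm hyt
  have h1 : mfderivWithin 𝓘(ℝ, E4) 𝓘(ℝ, ℝ) (h ∘ φ.symm) (Set.range (𝓡 4)) (φ y)
      = (mfderiv (𝓡 4) 𝓘(ℝ, ℝ) h (φ.symm (φ y))).comp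
        (mfderivWithin 𝓘(ℝ, E4) (𝓡 4) φ.symm (Set.range (𝓡 4)) (φ y)) := by
    refine mfderiv_comp_mfderivWithin (φ y) (by rw [hinv]; exact hh) hd ?_
    exact (𝓡 4).uniqueMDiffOn _ (extChartAt_target_subset_range x hyt)
  have h2 : fderiv ℝ (h ∘ φ.symm) (φ y) = (mfderiv (𝓡 4) 𝓘(ℝ, ℝ) h (φ.symm (φ y))).comp
        (mfderivWithin 𝓘(ℝ, E4) (𝓡 4) φ.symm (Set.range (𝓡 4)) (φ y)) := by
    rw [← h1, mfderivWithin_eq_fderivWithin]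
    simp
  rw [h2]
  change _ = (mfderiv (𝓡 4) 𝓘(ℝ, ℝ) h (φ.symm (φ y)))
    ((mfderivWithin 𝓘(ℝ, E4) (𝓡 4) φ.symm (Set.range (𝓡 4)) (φ y))
      ((mfderivWithin 𝓘(ℝ, E4) (𝓡 4) φ.symm (Set.range (𝓡 4)) (φ y)).inverse
        (Z (φ.symm (φ y)))))
  rw [hS.self_apply_inverse, hinv]
  rfl

theorem differentiableAt_chartField {x : M} {Z : Π x : M, TangentSpace (𝓡 4) x}
    (hZ : FieldDiffAt Z x) : DifferentiableAt ℝ (chartField x Z) (extChartAt (𝓡 4) x x) := by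
  have := MDifferentiableWithinAt.differentiableWithinAt_mpullbackWithin_vectorField
    (mdifferentiableWithinAt_univ.2 hZ)
  have hr : (extChartAt (𝓡 4) x).symm ⁻¹' Set.univ ∩ Set.range (𝓡 4) = Set.univ := by simp
  rw [hr] at this
  exact differentiableWithinAt_univ.1 this

open VectorField in
/-- The Lie bracket is the commutator of derivations. -/
theorem mvfderiv_mlieBracket {f : M → ℝ} {V W : Π x : M, TangentSpace (𝓡 4) x} {x : M}
    (hf : ContMDiff (𝓡 4) 𝓘(ℝ, ℝ) ∞ f) (hV : SmoothFieldAt V x) (hW : SmoothFieldAt W x) :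
    mvfderiv (𝓡 4) f x (mlieBracket (𝓡 4) V W x)
      = along V (along W f) x - along W (along V f) x := by
  have hx : x ∈ (extChartAt (𝓡 4) x).source := mem_extChartAt_source x
  have hfd : MDifferentiable (𝓡 4) 𝓘(ℝ, ℝ) f := hf.mdifferentiable (by simp)
  have hF : ContDiffAt ℝ ∞ (f ∘ (extChartAt (𝓡 4) x).symm) (extChartAt (𝓡 4) x x) := by
    have h := (contMDiffAt_iff.1 (hf.contMDiffAt (x := x))).2
    rw [ModelWithCorners.range_eq_univ, contDiffWithinAt_univ] at h
    exact h
  have hnhds : ∀ Z : Π x : M, TangentSpace (𝓡 4) x,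
      (along Z f) ∘ (extChartAt (𝓡 4) x).symm =ᶠ[𝓝 (extChartAt (𝓡 4) x x)]
      fun z => fderiv ℝ (f ∘ (extChartAt (𝓡 4) x).symm) z (chartField x Z z) := by
    intro Z
    filter_upwards [extChartAt_target_mem_nhds (I := 𝓡 4) x] with z hz
    have := mvfderiv_eq_fderiv_chart ((extChartAt (𝓡 4) x).map_target hz) (hfd _) Z
    rw [(extChartAt (𝓡 4) x).right_inv hz] at this
    exact this
  -- The differential of the chart at its own centre is the identity, so no transport is left on
  -- either side.
  have hb : chartField x (mlieBracket (𝓡 4) V W) (extChartAt (𝓡 4) x x)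
      = lieBracket ℝ (chartField x V) (chartField x W) (extChartAt (𝓡 4) x x) := by
    have hinv : (extChartAt (𝓡 4) x).symm (extChartAt (𝓡 4) x x) = x := extChartAt_to_inv x
    have e1 : chartField x (mlieBracket (𝓡 4) V W) (extChartAt (𝓡 4) x x)
        = mlieBracket (𝓡 4) V W x := by
      change (mfderivWithin 𝓘(ℝ, E4) (𝓡 4) (extChartAt (𝓡 4) x).symm (Set.range (𝓡 4))
        (extChartAt (𝓡 4) x x)).inverse (mlieBracket (𝓡 4) V W
          ((extChartAt (𝓡 4) x).symm (extChartAt (𝓡 4) x x))) = _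
      rw [hinv]
      exact mfderivWithin_extChartAt_symm_inverse_apply (v := mlieBracket (𝓡 4) V W x)
    have hr : (extChartAt (𝓡 4) x).symm ⁻¹' Set.univ ∩ Set.range (𝓡 4) = Set.univ := by simp
    have h1 : mlieBracket (𝓡 4) V W x = ContinuousLinearMap.inverse
        (show E4 →L[ℝ] E4 from mfderiv (𝓡 4) 𝓘(ℝ, E4) (extChartAt (𝓡 4) x) x)
        (lieBracketWithin ℝ (chartField x V) (chartField x W)
          ((extChartAt (𝓡 4) x).symm ⁻¹' Set.univ ∩ Set.range (𝓡 4)) (extChartAt (𝓡 4) x x)) := rfl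
    have h2 : ∀ A : E4 →L[ℝ] E4, A = ContinuousLinearMap.id ℝ E4 → ∀ u, A.inverse u = u := by
      rintro _ rfl u
      simp
    rw [hr, lieBracketWithin_univ] at h1
    exact e1.trans (h1.trans (h2 _ mfderiv_extChartAt_self _))
  have h0 := mvfderiv_eq_fderiv_chart hx (hfd x) (mlieBracket (𝓡 4) V W)
  rw [hb, fderiv_lieBracket hF (differentiableAt_chartField hV.fieldDiffAt)
    (differentiableAt_chartField hW.fieldDiffAt), ← (hnhds W).fderiv_eq,
    ← (hnhds V).fderiv_eq, ← mvfderiv_eq_fderiv_chart hx, ← mvfderiv_eq_fderiv_chart hx] at h0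
  · exact h0
  · exact (contMDiffAt_along hf hV).mdifferentiableAt (by simp)
  · exact (contMDiffAt_along hf hW).mdifferentiableAt (by simp)

end NullGeom

/-! ### Local frames and the derivative of a trace. -/

namespace NullGeom

variable {M : Type*} [TopologicalSpace M] [ChartedSpace E4 M] [IsManifold (𝓡 4) ∞ M]

/-- A smooth field of endomorphisms of the tangent spaces, at a point. -/
abbrev SmoothEndoAt (A : Π x : M, TangentSpace (𝓡 4) x →L[ℝ] TangentSpace (𝓡 4) x) (x : M) : Prop :=
  ContMDiffAt (𝓡 4) ((𝓡 4).prod 𝓘(ℝ, E4 →L[ℝ] E4)) ∞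
    (fun y => Bundle.TotalSpace.mk' (E4 →L[ℝ] E4)
      (E := fun y : M => TangentSpace (𝓡 4) y →L[ℝ] TangentSpace (𝓡 4) y) y (A y)) x

theorem SmoothEndoAt.apply {A : Π x : M, TangentSpace (𝓡 4) x →L[ℝ] TangentSpace (𝓡 4) x} {x : M}
    {X : Π x : M, TangentSpace (𝓡 4) x} (hA : SmoothEndoAt A x) (hX : SmoothFieldAt X x) :
    SmoothFieldAt (fun y => A y (X y)) x :=
  ContMDiffAt.clm_bundle_apply (F₁ := E4) (F₂ := E4) hA hX

/-- The trace of a field of endomorphisms. -/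
def traceField (A : Π x : M, TangentSpace (𝓡 4) x →L[ℝ] TangentSpace (𝓡 4) x) (x : M) : ℝ :=
  LinearMap.trace ℝ (TangentSpace (𝓡 4) x) (A x).toLinearMap

section frame

variable {ι : Type*} [Fintype ι] [DecidableEq ι] {x : M} (b : Module.Basis ι ℝ (TangentSpace (𝓡 4) x))

/-- Both sides are constant in the trivialization at `x`. This makes the extensions used in `ricci`
a smooth local frame. -/
theorem extend_eq_localFrame (i : ι) {y : M}
    (hy : y ∈ (trivializationAt E4 (TangentSpace (𝓡 4)) x).baseSet) :
    FiberBundle.extend E4 (b i) y = (trivializationAt E4 (TangentSpace (𝓡 4)) x).localFrame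
      (b.map ((trivializationAt E4 (TangentSpace (𝓡 4)) x).linearEquivAt ℝ x
        (FiberBundle.mem_baseSet_trivializationAt' x))) i y := by
  rw [Bundle.Trivialization.localFrame_apply_of_mem_baseSet _ _ hy]
  simp [Bundle.Trivialization.basisAt, FiberBundle.extend]

theorem isLocalFrameOn_extend : IsLocalFrameOn (𝓡 4) E4 1
    (fun i => FiberBundle.extend E4 (b i) : ι → Π y : M, TangentSpace (𝓡 4) y)
    (trivializationAt E4 (TangentSpace (𝓡 4)) x).baseSet := by
  set e := trivializationAt E4 (TangentSpace (𝓡 4) : M → Type _) x with he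
  have hx : x ∈ e.baseSet := FiberBundle.mem_baseSet_trivializationAt' x
  refine (e.isLocalFrameOn_localFrame_baseSet (𝓡 4) 1 (b.map (e.linearEquivAt ℝ x hx))).congr ?_
  exact fun i y hy => (extend_eq_localFrame b i hy).symm

/-- The coefficients in the frame extending a basis. -/
def frameCoeff (i : ι) (y : M) : TangentSpace (𝓡 4) y →ₗ[ℝ] ℝ := (isLocalFrameOn_extend b).coeff i y

theorem frameCoeff_self (i : ι) (v : TangentSpace (𝓡 4) x) : frameCoeff b i x v = b.repr v i := by
  have hx := FiberBundle.mem_baseSet_trivializationAt' (F := E4) (E := (TangentSpace (𝓡 4) : M → Type _)) x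
  have h := (isLocalFrameOn_extend b).coeff_apply_of_mem hx (FiberBundle.extend E4 v) i
  have hb : (isLocalFrameOn_extend b).toBasisAt hx = b := by
    ext j
    simp
  rw [hb, FiberBundle.extend_apply_self] at h
  exact h

theorem contMDiffAt_frameCoeff {Y : Π y : M, TangentSpace (𝓡 4) y} (hY : SmoothFieldAt Y x) (i : ι) :
    ContMDiffAt (𝓡 4) 𝓘(ℝ, ℝ) ∞ (fun y => frameCoeff b i y (Y y)) x := by
  set e := trivializationAt E4 (TangentSpace (𝓡 4) : M → Type _) x with he
  have hx : x ∈ e.baseSet := FiberBundle.mem_baseSet_trivializationAt' x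
  set b' := b.map (e.linearEquivAt ℝ x hx)
  refine (contMDiffAt_localFrameCoeff b' hx hY i).congr_of_eventuallyEq ?_
  filter_upwards [e.open_baseSet.mem_nhds hx] with y hy
  refine IsLocalFrameOn.coeff_eq_of_eq (isLocalFrameOn_extend b)
    (e.isLocalFrameOn_localFrame_baseSet (𝓡 4) 1 b') (fun j => ?_) i
  exact extend_eq_localFrame b j hy

theorem eventually_eq_frame (Y : Π y : M, TangentSpace (𝓡 4) y) :
    ∀ᶠ y in 𝓝 x, Y y = ∑ i, frameCoeff b i y (Y y) • FiberBundle.extend E4 (b i) y :=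
  (isLocalFrameOn_extend b).eventually_eq_sum_coeff_smul Y
    ((trivializationAt E4 (TangentSpace (𝓡 4)) x).open_baseSet.mem_nhds
      (FiberBundle.mem_baseSet_trivializationAt' x))

theorem eventually_traceField (A : Π x : M, TangentSpace (𝓡 4) x →L[ℝ] TangentSpace (𝓡 4) x) :
    traceField A =ᶠ[𝓝 x] 
      fun y => ∑ i, frameCoeff b i y (A y (FiberBundle.extend E4 (b i) y)) := by
  filter_upwards [(trivializationAt E4 (TangentSpace (𝓡 4)) x).open_baseSet.mem_nhds
      (FiberBundle.mem_baseSet_trivializationAt' x)] with y hy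
  rw [traceField, LinearMap.trace_eq_matrix_trace ℝ ((isLocalFrameOn_extend b).toBasisAt hy)]
  simp only [Matrix.trace, Matrix.diag_apply, LinearMap.toMatrix_apply, frameCoeff]
  refine Finset.sum_congr rfl fun i _ => ?_
  have h := (isLocalFrameOn_extend b).coeff_apply_of_mem hy
    (fun z => A z (FiberBundle.extend E4 (b i) z)) i
  rw [h]
  simp

end frame

theorem contMDiffAt_traceField {A : Π x : M, TangentSpace (𝓡 4) x →L[ℝ] TangentSpace (𝓡 4) x}
    {x : M} (hA : SmoothEndoAt A x) : ContMDiffAt (𝓡 4) 𝓘(ℝ, ℝ) ∞ (traceField A) x := by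
  have b := Module.finBasis ℝ (TangentSpace (𝓡 4) x)
  refine ContMDiffAt.congr_of_eventuallyEq ?_ (eventually_traceField b A)
  refine ContMDiffAt.sum fun i _ => contMDiffAt_frameCoeff b (hA.apply ?_) i
  exact FiberBundle.contMDiffAt_extend (𝓡 4) E4 (b i)

theorem mvfderiv_sum {ι : Type*} (s : Finset ι) {x : M} (f : ι → M → ℝ)
    (hf : ∀ i, MDifferentiableAt (𝓡 4) 𝓘(ℝ, ℝ) (f i) x) :
    MDifferentiableAt (𝓡 4) 𝓘(ℝ, ℝ) (fun y => ∑ i ∈ s, f i y) x ∧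
    ∀ v, mvfderiv (𝓡 4) (fun y => ∑ i ∈ s, f i y) x v = ∑ i ∈ s, mvfderiv (𝓡 4) (f i) x v := by
  classical
  induction s using Finset.induction_on with
  | empty => simpa using ⟨mdifferentiableAt_const, fun v => by rw [mvfderiv_const]; rfl⟩
  | insert j s hj ih =>
    have e : (fun y => ∑ i ∈ insert j s, f i y) = f j + fun y => ∑ i ∈ s, f i y := by
      ext1 y
      simp [Finset.sum_insert hj]
    rw [e]
    refine ⟨(hf j).add ih.1, fun v => ?_⟩
    rw [mvfderiv_add (hf j) ih.1, Finset.sum_insert hj, ← ih.2]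
    rfl

/-- The Leibniz rule for linear combinations. -/
theorem Connection.sum_smul (nabla : Connection M) {ι : Type*} (s : Finset ι) {x : M}
    (f : ι → M → ℝ) (X : ι → Π x : M, TangentSpace (𝓡 4) x)
    (hf : ∀ i, MDifferentiableAt (𝓡 4) 𝓘(ℝ, ℝ) (f i) x) (hX : ∀ i, FieldDiffAt (X i) x) :
    FieldDiffAt (fun y => ∑ i ∈ s, f i y • X i y) x ∧
    ∀ v, nabla (fun y => ∑ i ∈ s, f i y • X i y) x v
      = ∑ i ∈ s, (f i x • nabla (X i) x v + mvfderiv (𝓡 4) (f i) x v • X i x) := by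
  classical
  induction s using Finset.induction_on with
  | empty =>
    refine ⟨?_, fun v => ?_⟩
    · simpa using! Bundle.mdifferentiableAt_zeroSection (IB := 𝓡 4) (F := E4) ℝ (TangentSpace (𝓡 4) : M → Type _) (x := x)
    · have : (fun y => ∑ i ∈ ∅, f i y • X i y) = (0 : Π x : M, TangentSpace (𝓡 4) x) := by
        ext1 y; simp
      rw [this, CovariantDerivative.zero]
      simp
  | insert j s hj ih =>
    obtain ⟨h1, h2⟩ := ih
    have hj1 : FieldDiffAt (f j • X j) x := (hf j).smul_section (hX j)
    have e : (fun y => ∑ i ∈ insert j s, f i y • X i y)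
        = f j • X j + fun y => ∑ i ∈ s, f i y • X i y := by
      ext1 y
      simp [Finset.sum_insert hj]
    rw [e]
    refine ⟨mdifferentiableAt_add_section hj1 h1, fun v => ?_⟩
    rw [nabla.isCovariantDerivativeOnUniv.add hj1 h1,
      nabla.isCovariantDerivativeOnUniv.leibniz (hX j) (hf j), Finset.sum_insert hj, ← h2]
    rfl

/-- The trace commutes with covariant differentiation: in a frame, `∇_v A` is the matrix of
differentiated coefficients plus a commutator with the connection matrix, and commutators are
traceless. -/
theorem sum_repr_eq_mvfderiv_traceField (nabla : Connection M)
    {A : Π x : M, TangentSpace (𝓡 4) x →L[ℝ] TangentSpace (𝓡 4) x}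
    {x : M} (hA : SmoothEndoAt A x) {ι : Type*} [Fintype ι] [DecidableEq ι]
    (b : Module.Basis ι ℝ (TangentSpace (𝓡 4) x)) (v : TangentSpace (𝓡 4) x) :
    ∑ i, b.repr (nabla (fun y => A y (FiberBundle.extend E4 (b i) y)) x v
      - A x (nabla (FiberBundle.extend E4 (b i)) x v)) i = mvfderiv (𝓡 4) (traceField A) x v := by
  set X : ι → Π y : M, TangentSpace (𝓡 4) y := fun i => FiberBundle.extend E4 (b i) with hX
  have hXs : ∀ i, SmoothFieldAt (X i) x := fun i => FiberBundle.contMDiffAt_extend (𝓡 4) E4 (b i)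
  have hXx : ∀ i, X i x = b i := fun i => FiberBundle.extend_apply_self E4 (b i)
  set a : ι → ι → M → ℝ := fun j i y => frameCoeff b j y (A y (X i y)) with ha
  have has : ∀ i j, MDifferentiableAt (𝓡 4) 𝓘(ℝ, ℝ) (a j i) x := fun i j =>
    (contMDiffAt_frameCoeff b (hA.apply (hXs i)) j).mdifferentiableAt (by simp)
  have ha0 : ∀ i j, a j i x = b.repr (A x (b i)) j := fun i j => by
    simp only [ha]
    rw [frameCoeff_self, hXx]
  have h1 : ∀ i, nabla (fun y => A y (X i y)) x v
      = ∑ j, (a j i x • nabla (X j) x v + mvfderiv (𝓡 4) (a j i) x v • b j) := by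
    intro i
    obtain ⟨h2, h3⟩ := Connection.sum_smul nabla Finset.univ (fun j => a j i) X (has i)
      (fun j => (hXs j).fieldDiffAt)
    rw [nabla.isCovariantDerivativeOnUniv.congr_of_eventuallyEq (hA.apply (hXs i)).fieldDiffAt h2
      Filter.univ_mem (eventually_eq_frame b _), h3]
    simp only [hXx]
  have h4 : mvfderiv (𝓡 4) (traceField A) x v = ∑ i, mvfderiv (𝓡 4) (a i i) x v := by
    have := along_congr (X := FiberBundle.extend E4 v) (eventually_traceField b A)
    simp only [along, FiberBundle.extend_apply_self] at this
    rw [this]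
    exact (mvfderiv_sum Finset.univ (fun i => a i i) fun i => has i i).2 v
  have h5 : ∀ i, b.repr (A x (nabla (X i) x v)) i
      = ∑ k, b.repr (nabla (X i) x v) k * a i k x := by
    intro i
    have h := congrArg (fun u => b.repr (A x u) i) (b.sum_repr (nabla (X i) x v))
    simp only [map_sum, map_smul, Finsupp.coe_finsetSum, Finset.sum_apply, Finsupp.smul_apply,
      smul_eq_mul] at h
    simp only [ha0]
    exact h.symm
  change ∑ i, b.repr (nabla (fun y => A y (X i y)) x v - A x (nabla (X i) x v)) i = _
  simp only [map_sub, Finsupp.sub_apply, h1, h5, h4, map_sum, map_add, map_smul,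
    Finsupp.coe_finsetSum, Finset.sum_apply, Finsupp.add_apply, Finsupp.smul_apply, smul_eq_mul,
    Finset.sum_sub_distrib, Finset.sum_add_distrib, Module.Basis.repr_self, Finsupp.single_apply]
  -- The two double sums of connection terms are the trace of one product taken in both orders.
  rw [Finset.sum_comm]
  simp [mul_comm]

end NullGeom

/-! ### Null hypersurfaces: shape operator, generators, tetrads. -/

namespace NullGeom

variable {M : Type*} [TopologicalSpace M] [ChartedSpace E4 M] [IsManifold (𝓡 4) ∞ M]

/-- Such a `Z` is orthogonal to the timelike `T`, where the form is negative definite, and yet has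
square zero. -/
theorem LorentzMetric.nondegenerate (g : LorentzMetric M) {x : M} {Z : TangentSpace (𝓡 4) x}
    (h : ∀ W, g.form x Z W = 0) : Z = 0 := by
  obtain ⟨T, -, hT⟩ := g.signature x
  by_contra hZ
  have := hT Z hZ (by rw [g.symm]; exact h T)
  rw [h Z] at this
  exact lt_irrefl _ this

theorem mvfderiv_form {g : LorentzMetric M} {nabla : Connection M} (hn : IsLeviCivita g nabla)
    {Y Z : Π x : M, TangentSpace (𝓡 4) x} {x : M} (hY : FieldDiffAt Y x) (hZ : FieldDiffAt Z x)
    (X : TangentSpace (𝓡 4) x) :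
    mvfderiv (𝓡 4) (fun y => g.form y (Y y) (Z y)) x X
      = g.form x (nabla Y x X) (Z x) + g.form x (Y x) (nabla Z x X) :=
  hn.metric Y Z x X hY hZ

section

variable {g : LorentzMetric M} {nabla : Connection M} {v : M → ℝ}
  {D : Π x : M, TangentSpace (𝓡 4) x}

theorem IsNullFoliation.smoothFieldAt (hD : IsNullFoliation g v D) (x : M) : SmoothFieldAt D x :=
  hD.smooth_D x

theorem IsNullFoliation.normal' (hD : IsNullFoliation g v D) {x : M} {X : TangentSpace (𝓡 4) x} :
    mvfderiv (𝓡 4) v x X = 0 ↔ g.form x (D x) X = 0 :=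
  hD.normal x X

theorem IsNullFoliation.exists_transverse (hD : IsNullFoliation g v D) (x : M) :
    ∃ N : TangentSpace (𝓡 4) x, g.form x (D x) N ≠ 0 := by
  by_contra! h
  exact hD.ne_zero x (g.nondegenerate h)

theorem IsLeviCivita.smoothEndoAt (hn : IsLeviCivita g nabla) (hD : IsNullFoliation g v D) (x : M) :
    SmoothEndoAt (nabla D) x := by
  have h := hn.smooth.contMDiff.contMDiff (σ := D)
    (by simpa using hD.smooth_D.contMDiffOn)
  exact (h x (Set.mem_univ x)).contMDiffAt Filter.univ_mem

theorem form_nabla_self (hn : IsLeviCivita g nabla) (hD : IsNullFoliation g v D) {x : M}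
    (X : TangentSpace (𝓡 4) x) : g.form x (nabla D x X) (D x) = 0 := by
  have hd := (hD.smoothFieldAt x).fieldDiffAt
  have h := mvfderiv_form hn hd hd X
  have h0 : (fun y => g.form y (D y) (D y)) = fun _ => (0 : ℝ) := funext hD.isNull
  rw [h0, mvfderiv_const, g.symm x (D x)] at h
  have h1 : (0 : ℝ) = g.form x (nabla D x X) (D x) + g.form x (nabla D x X) (D x) := h
  linarith

/-- The shape operator of a null hypersurface is symmetric. -/
theorem form_nabla_symm (hn : IsLeviCivita g nabla) (hD : IsNullFoliation g v D) {x : M}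
    {X Y : TangentSpace (𝓡 4) x} (hX : g.form x (D x) X = 0) (hY : g.form x (D x) Y = 0) :
    g.form x (nabla D x X) Y = g.form x (nabla D x Y) X := by
  obtain ⟨N₀, hN₀⟩ := hD.exists_transverse x
  set N : Π y : M, TangentSpace (𝓡 4) y := FiberBundle.extend E4 N₀
  have hNs : SmoothFieldAt N x := FiberBundle.contMDiffAt_extend (𝓡 4) E4 N₀
  have hNx : N x = N₀ := FiberBundle.extend_apply_self E4 N₀
  have hDs := hD.smoothFieldAt x
  have hvN : along N v x ≠ 0 := by
    intro h
    apply hN₀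
    rw [← hNx]
    exact hD.normal'.1 h
  have hNv := contMDiffAt_along hD.smooth_v hNs
  have hDN := g.contMDiffAt_form hDs hNs
  -- `g(D, ·)` and `dv` have the same kernel, so they are proportional; the factor `l` is read off
  -- on the transverse field `N`.
  set l : M → ℝ := fun y => g.form y (D y) (N y) / along N v y with hl
  have hls : ContMDiffAt (𝓡 4) 𝓘(ℝ, ℝ) ∞ l x := hDN.div₀ hNv hvN
  have hev : ∀ᶠ y in 𝓝 x, ∀ Z : TangentSpace (𝓡 4) y,
      g.form y (D y) Z = l y * mvfderiv (𝓡 4) v y Z := by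
    filter_upwards [hNv.continuousAt.eventually_ne hvN] with y hy Z
    have h0 : mvfderiv (𝓡 4) v y (Z - (mvfderiv (𝓡 4) v y Z / along N v y) • N y) = 0 := by
      rw [map_sub, map_smul, smul_eq_mul, div_mul_cancel₀ _ hy, sub_self]
    rw [hD.normal', map_sub, map_smul, smul_eq_mul, sub_eq_zero] at h0
    rw [h0, hl]
    ring
  -- Differentiate `g(D, Y) = l · Y(v)` along `X`; the term with the derivative of `l` drops out
  -- because `Y(v) = 0` at `x`.
  have main : ∀ X Y : TangentSpace (𝓡 4) x, g.form x (D x) Y = 0 →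
      l x * along (FiberBundle.extend E4 X) (along (FiberBundle.extend E4 Y) v) x
      = g.form x (nabla D x X) Y + g.form x (D x) (nabla (FiberBundle.extend E4 Y) x X) := by
    intro X Y hY
    have hYs : SmoothFieldAt (FiberBundle.extend E4 Y : Π y : M, TangentSpace (𝓡 4) y) x :=
      FiberBundle.contMDiffAt_extend (𝓡 4) E4 Y
    have h1 := mvfderiv_form hn hDs.fieldDiffAt hYs.fieldDiffAt X
    rw [FiberBundle.extend_apply_self] at h1
    rw [← h1]
    have e : (fun y => g.form y (D y) (FiberBundle.extend E4 Y y)) =ᶠ[𝓝 x]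
        l * along (FiberBundle.extend E4 Y) v := by
      filter_upwards [hev] with y hy
      exact hy _
    have e2 := along_congr (X := FiberBundle.extend E4 X) e
    have hYv := contMDiffAt_along hD.smooth_v hYs
    simp only [along, FiberBundle.extend_apply_self] at e2 ⊢
    rw [e2, mvfderiv_mul (hls.mdifferentiableAt (by simp)) (hYv.mdifferentiableAt (by simp))]
    have h0 : along (FiberBundle.extend E4 Y) v x = 0 := by
      simp only [along, FiberBundle.extend_apply_self]
      exact hD.normal'.2 hY
    simp [h0]
  have hXs : SmoothFieldAt (FiberBundle.extend E4 X : Π y : M, TangentSpace (𝓡 4) y) x :=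
      FiberBundle.contMDiffAt_extend (𝓡 4) E4 X
  have hYs : SmoothFieldAt (FiberBundle.extend E4 Y : Π y : M, TangentSpace (𝓡 4) y) x :=
      FiberBundle.contMDiffAt_extend (𝓡 4) E4 Y
  have h1 := main X Y hY
  have h2 := main Y X hX
  have h3 := mvfderiv_mlieBracket hD.smooth_v hXs hYs
  have h4 := (nabla.torsion_eq_zero_iff.1 hn.torsion_free) hXs.fieldDiffAt hYs.fieldDiffAt
  simp only [FiberBundle.extend_apply_self] at h4
  -- Antisymmetrizing `main` in `X` and `Y`, the terms `g(D, ∇_X Y - ∇_Y X) = g(D, [X,Y]) = l ·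
  -- [X,Y](v)` cancel the commutator on the left.
  have h5 := hev.self_of_nhds (VectorField.mlieBracket (𝓡 4) (FiberBundle.extend E4 X)
    (FiberBundle.extend E4 Y) x)
  rw [h3, ← h4, map_sub] at h5
  linarith

/-- This is κ = 0: symmetry of the shape operator turns the expression into half the derivative of
`g(D,D) = 0` along `Y`. -/
theorem form_nabla_along_self (hn : IsLeviCivita g nabla) (hD : IsNullFoliation g v D) {x : M}
    {Y : TangentSpace (𝓡 4) x} (hY : g.form x (D x) Y = 0) :
    g.form x (nabla D x (D x)) Y = 0 := by
  rw [form_nabla_symm hn hD (hD.isNull x) hY]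
  exact form_nabla_self hn hD Y

/-- The null generators are geodesics up to parametrization. -/
theorem nabla_self (hn : IsLeviCivita g nabla) (hD : IsNullFoliation g v D) {x : M}
    {N : TangentSpace (𝓡 4) x} (hN : g.form x (D x) N ≠ 0) :
    nabla D x (D x) = (g.form x (nabla D x (D x)) N / g.form x (D x) N) • D x := by
  rw [← sub_eq_zero]
  refine g.nondegenerate fun W => ?_
  -- Every `W` differs from a vector orthogonal to `D` by a multiple of `N`, so only the component
  -- along `N` has to be matched.
  have h0 : g.form x (D x) (W - (g.form x (D x) W / g.form x (D x) N) • N) = 0 := by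
    rw [map_sub, map_smul, smul_eq_mul, div_mul_cancel₀ _ hN, sub_self]
  have h1 := form_nabla_along_self hn hD h0
  simp only [map_sub, map_smul, _root_.sub_apply, _root_.smul_apply, smul_eq_mul] at h1 ⊢
  rw [← h1]
  ring

end

namespace NullTetrad

variable {g : LorentzMetric M} {nabla : Connection M} {v : M → ℝ}
  {D : Π x : M, TangentSpace (𝓡 4) x} {x : M}

theorem X_X' (t : NullTetrad g D x) : g.form x t.X t.X = -t.chi2 / 2 := by
  have := t.delta_delta'; have := t.X_X; linarith

theorem Y_Y' (t : NullTetrad g D x) : g.form x t.Y t.Y = -t.chi2 / 2 := by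
  have := t.delta_delta'; have := t.X_X; linarith

theorem linearIndependent (t : NullTetrad g D x) :
    LinearIndependent ℝ ![D x, t.D', t.X, t.Y] := by
  rw [Fintype.linearIndependent_iff]
  intro c hc
  simp only [Fin.sum_univ_four, Matrix.cons_val_zero, Matrix.cons_val_one, Matrix.cons_val] at hc
  have hp : ∀ W, c 0 * g.form x (D x) W + c 1 * g.form x t.D' W + c 2 * g.form x t.X W
      + c 3 * g.form x t.Y W = 0 := by
    intro W
    have := congrArg (fun u => g.form x u W) hc
    simpa using! this
  have hpos := t.chi2_pos
  have h1 := hp t.D'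
  have h0 := hp (D x)
  have h2 := hp t.X
  have h3 := hp t.Y
  rw [g.symm x t.D' (D x), g.symm x t.X (D x), g.symm x t.Y (D x), t.D_D, t.D_D', t.D_X, t.D_Y] at h0
  rw [g.symm x t.X t.D', g.symm x t.Y t.D', t.D'_D', t.D_D', t.D'_X, t.D'_Y] at h1
  rw [g.symm x t.Y t.X, t.D_X, t.D'_X, t.X_X', t.X_Y] at h2
  rw [t.D_Y, t.D'_Y, t.Y_Y', t.X_Y] at h3
  intro i
  fin_cases i <;> simp <;> nlinarith

/-- The real basis underlying a null tetrad. -/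
def basis (t : NullTetrad g D x) : Module.Basis (Fin 4) ℝ (TangentSpace (𝓡 4) x) :=
  basisOfLinearIndependentOfCardEqFinrank t.linearIndependent
    (by rw [show Module.finrank ℝ (TangentSpace (𝓡 4) x) = Module.finrank ℝ E4 from rfl]; simp)

/-- Pairing with the tetrad isolates each coefficient; the factor -2 arises because `X` and `Y` have
square `-χχ̄/2`. -/
theorem repr (t : NullTetrad g D x) (Z : TangentSpace (𝓡 4) x) :
    (t.basis.repr Z 0 = g.form x Z t.D' / t.chi2 ∧ t.basis.repr Z 1 = g.form x Z (D x) / t.chi2) ∧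
    t.basis.repr Z 2 = -2 * g.form x Z t.X / t.chi2 ∧
    t.basis.repr Z 3 = -2 * g.form x Z t.Y / t.chi2 := by
  have h := t.basis.sum_repr Z
  simp only [Fin.sum_univ_four, basis, coe_basisOfLinearIndependentOfCardEqFinrank,
    Matrix.cons_val_zero, Matrix.cons_val_one, Matrix.cons_val] at h
  change t.basis.repr Z 0 • _ + t.basis.repr Z 1 • _ + t.basis.repr Z 2 • _
    + t.basis.repr Z 3 • _ = _ at h
  have hp : ∀ W, g.form x Z W = t.basis.repr Z 0 * g.form x (D x) W
      + t.basis.repr Z 1 * g.form x t.D' W + t.basis.repr Z 2 * g.form x t.X W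
      + t.basis.repr Z 3 * g.form x t.Y W := by
    intro W
    have := congrArg (fun u => g.form x u W) h
    simpa using! this.symm
  have hpos := t.chi2_pos.ne'
  have h1 := hp t.D'
  have h0 := hp (D x)
  have h2 := hp t.X
  have h3 := hp t.Y
  rw [g.symm x t.D' (D x), g.symm x t.X (D x), g.symm x t.Y (D x), t.D_D, t.D_D', t.D_X, t.D_Y] at h0
  rw [g.symm x t.X t.D', g.symm x t.Y t.D', t.D'_D', t.D_D', t.D'_X, t.D'_Y] at h1
  rw [g.symm x t.Y t.X, t.D_X, t.D'_X, t.X_X', t.X_Y] at h2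
  rw [t.D_Y, t.D'_Y, t.Y_Y', t.X_Y] at h3
  refine ⟨⟨?_, ?_⟩, ?_, ?_⟩ <;> rw [eq_div_iff hpos] <;> linarith

theorem trace_eq (t : NullTetrad g D x) (A : TangentSpace (𝓡 4) x →ₗ[ℝ] TangentSpace (𝓡 4) x) :
    LinearMap.trace ℝ _ A = (g.form x (A (D x)) t.D' + g.form x (A t.D') (D x)
      - 2 * g.form x (A t.X) t.X - 2 * g.form x (A t.Y) t.Y) / t.chi2 := by
  have hb : ∀ i, t.basis i = ![D x, t.D', t.X, t.Y] i := by
    intro i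
    simp [basis]
  rw [LinearMap.trace_eq_matrix_trace ℝ t.basis]
  simp only [Matrix.trace, Matrix.diag_apply, LinearMap.toMatrix_apply, Fin.sum_univ_four, hb,
    Matrix.cons_val_zero, Matrix.cons_val_one, Matrix.cons_val, (t.repr _).1.1, (t.repr _).1.2,
    (t.repr _).2.1, (t.repr _).2.2]
  ring

end NullTetrad

end NullGeom

/-! ### Spin coefficients and the focusing equation. -/

namespace NullGeom

variable {M : Type*} [TopologicalSpace M] [ChartedSpace E4 M] [IsManifold (𝓡 4) ∞ M]
variable {g : LorentzMetric M} {nabla : Connection M} {v : M → ℝ}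
  {D : Π x : M, TangentSpace (𝓡 4) x} {x : M}

namespace NullTetrad

theorem nabla_self (hn : IsLeviCivita g nabla) (hD : IsNullFoliation g v D)
    (t : NullTetrad g D x) : nabla D x (D x) = t.epsSum nabla • D x := by
  have h := NullGeom.nabla_self hn hD (N := t.D') (by rw [t.D_D']; exact t.chi2_pos.ne')
  rw [t.D_D'] at h
  exact h

/-- The real part of `ρ`. -/
def rate (nabla : Connection M) (t : NullTetrad g D x) : ℝ :=
  (g.form x (nabla D x t.X) t.X + g.form x (nabla D x t.Y) t.Y) / t.chi2

/-- The imaginary part of ρ is the antisymmetric part of the shape operator, hence zero: the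
generators are hypersurface orthogonal. -/
theorem rho_eq (hn : IsLeviCivita g nabla) (hD : IsNullFoliation g v D) (t : NullTetrad g D x) :
    t.rho nabla = (t.rate nabla : ℂ) := by
  have hs := form_nabla_symm hn hD t.D_X t.D_Y
  have hpos := t.chi2_pos.ne'
  rw [rho, rate, hs, sub_self, Complex.ofReal_div]
  congr 1

theorem normSq_sigma (hn : IsLeviCivita g nabla) (hD : IsNullFoliation g v D)
    (t : NullTetrad g D x) : ‖t.sigma nabla‖ ^ 2
      = ((g.form x (nabla D x t.X) t.X - g.form x (nabla D x t.Y) t.Y) ^ 2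
        + (2 * g.form x (nabla D x t.X) t.Y) ^ 2) / t.chi2 ^ 2 := by
  have hs := form_nabla_symm hn hD t.D_X t.D_Y
  rw [sigma, norm_div, div_pow, ← Complex.normSq_eq_norm_sq, Complex.normSq_mk, Complex.norm_real,
    ← hs, Real.norm_eq_abs, sq_abs]
  ring_nf

/-- The `D'` contribution `g(∇_{D'} D, D)` vanishes since `D` is null. This ties ρ to quantities
that do not involve the tetrad. -/
theorem traceField_nabla (hn : IsLeviCivita g nabla) (hD : IsNullFoliation g v D)
    (t : NullTetrad g D x) : traceField (nabla D) x = t.epsSum nabla - 2 * t.rate nabla := by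
  rw [traceField, t.trace_eq]
  simp only [ContinuousLinearMap.coe_coe, form_nabla_self hn hD, epsSum, rate]
  ring

/-- `∇D` takes values in `D^⊥` and has `D` as an eigenvector with eigenvalue `ε + ε̄`; on the screen
`D^⊥/D` it is a symmetric 2×2 matrix with trace part ρ and tracefree part σ, whose square has trace
`2ρ² + 2|σ|²`. -/
theorem trace_nabla_sq (hn : IsLeviCivita g nabla) (hD : IsNullFoliation g v D)
    (t : NullTetrad g D x) :
    LinearMap.trace ℝ _ ((nabla D x).toLinearMap ∘ₗ (nabla D x).toLinearMap)
      = t.epsSum nabla ^ 2 + 2 * t.rate nabla ^ 2 + 2 * ‖t.sigma nabla‖ ^ 2 := by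
  have hpos := t.chi2_pos.ne'
  have hs := form_nabla_symm hn hD t.D_X t.D_Y
  have hAD := t.nabla_self hn hD
  have hb : ∀ i, t.basis i = ![D x, t.D', t.X, t.Y] i := by
    intro i
    simp [basis]
  have expand : ∀ Z, nabla D x (nabla D x Z) = (g.form x (nabla D x Z) t.D' / t.chi2) • nabla D x (D x)
      + (-2 * g.form x (nabla D x Z) t.X / t.chi2) • nabla D x t.X
      + (-2 * g.form x (nabla D x Z) t.Y / t.chi2) • nabla D x t.Y := by
    intro Z
    have h := t.basis.sum_repr (nabla D x Z)
    simp only [Fin.sum_univ_four, hb, Matrix.cons_val_zero, Matrix.cons_val_one, Matrix.cons_val,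
      (t.repr _).1.1, (t.repr _).1.2, (t.repr _).2.1, (t.repr _).2.2, form_nabla_self hn hD,
      zero_div, zero_smul, add_zero] at h
    conv_lhs => rw [← h]
    simp only [map_add, map_smul]
  rw [t.trace_eq, normSq_sigma hn hD]
  simp only [LinearMap.comp_apply, ContinuousLinearMap.coe_coe, form_nabla_self hn hD]
  rw [expand t.X, expand t.Y, hAD]
  simp only [map_add, map_smul, _root_.add_apply, _root_.smul_apply, smul_eq_mul, hAD, t.D_D',
    t.D_X, t.D_Y, rate]
  rw [← hs]
  field_simp
  ring

/-- As `∇_D D` is a multiple of `D`, any `N` transverse to `D` recovers the factor. Choosing `N`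
smooth gives smoothness of `ε + ε̄`, although the tetrads `t` need not vary even continuously. -/
theorem epsSum_eq (hn : IsLeviCivita g nabla) (hD : IsNullFoliation g v D)
    (t : NullTetrad g D x) {N : TangentSpace (𝓡 4) x} (hN : g.form x (D x) N ≠ 0) :
    t.epsSum nabla = g.form x (nabla D x (D x)) N / g.form x (D x) N := by
  rw [t.nabla_self hn hD]
  simp [hN]

theorem rate_eq (hn : IsLeviCivita g nabla) (hD : IsNullFoliation g v D)
    (t t' : NullTetrad g D x) : t.rate nabla = t'.rate nabla := by
  have hN : g.form x (D x) t.D' ≠ 0 := by rw [t.D_D']; exact t.chi2_pos.ne'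
  have h1 := t.traceField_nabla hn hD
  have h2 := t'.traceField_nabla hn hD
  rw [t.epsSum_eq hn hD hN] at h1
  rw [t'.epsSum_eq hn hD hN] at h2
  linarith

/-- The null rotation of a tetrad about `D`. -/
def rotate (t : NullTetrad g D x) (a b : ℝ) : NullTetrad g D x where
  D' := t.D' + (2 * a) • t.X + (2 * b) • t.Y + (a ^ 2 + b ^ 2) • D x
  X := t.X + a • D x
  Y := t.Y + b • D x
  chi2 := t.chi2
  chi2_pos := t.chi2_pos
  D_D := t.D_D
  D'_D' := by
    simp only [map_add, map_smul, _root_.add_apply, _root_.smul_apply, smul_eq_mul,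
      g.symm x t.D' (D x), g.symm x t.X (D x), g.symm x t.Y (D x), t.D_D, t.D_D', t.D_X, t.D_Y,
      g.symm x t.X t.D', g.symm x t.Y t.D', t.D'_D', t.D'_X, t.D'_Y, g.symm x t.Y t.X, t.X_X',
      t.X_Y, t.Y_Y']
    ring
  D_D' := by
    simp only [map_add, map_smul, smul_eq_mul, t.D_D, t.D_D', t.D_X, t.D_Y]
    ring
  D_X := by simp [t.D_D, t.D_X]
  D_Y := by simp [t.D_D, t.D_Y]
  D'_X := by
    simp only [map_add, map_smul, _root_.add_apply, _root_.smul_apply, smul_eq_mul,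
      g.symm x t.D' (D x), g.symm x t.X (D x), g.symm x t.Y (D x), t.D_D, t.D_D', t.D_X, t.D_Y,
      t.D'_X, g.symm x t.Y t.X, t.X_X', t.X_Y]
    ring
  D'_Y := by
    simp only [map_add, map_smul, _root_.add_apply, _root_.smul_apply, smul_eq_mul,
      g.symm x t.D' (D x), g.symm x t.X (D x), g.symm x t.Y (D x), t.D_D, t.D_D', t.D_X, t.D_Y,
      t.D'_Y, t.X_Y, t.Y_Y']
    ring
  X_X := by
    simp only [map_add, map_smul, _root_.add_apply, _root_.smul_apply, smul_eq_mul,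
      g.symm x t.X (D x), g.symm x t.Y (D x), t.D_D, t.D_X, t.D_Y, t.X_X', t.Y_Y']
    ring
  X_Y := by
    simp only [map_add, map_smul, _root_.add_apply, _root_.smul_apply, smul_eq_mul,
      g.symm x t.X (D x), t.D_D, t.D_X, t.D_Y, t.X_Y]
    ring
  delta_delta' := by
    simp only [map_add, map_smul, _root_.add_apply, _root_.smul_apply, smul_eq_mul,
      g.symm x t.X (D x), g.symm x t.Y (D x), t.D_D, t.D_X, t.D_Y, t.X_X', t.Y_Y']
    ring

/-- Vectors tangent to the null hypersurface that are not spacelike are multiples of `D`. -/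
theorem form_self_neg_or (t : NullTetrad g D x) {Z : TangentSpace (𝓡 4) x}
    (hZ : g.form x (D x) Z = 0) : g.form x Z Z < 0 ∨ ∃ a : ℝ, Z = a • D x := by
  have hpos := t.chi2_pos
  have hb : ∀ i, t.basis i = ![D x, t.D', t.X, t.Y] i := by
    intro i
    simp [basis]
  have h := t.basis.sum_repr Z
  simp only [Fin.sum_univ_four, hb, Matrix.cons_val_zero, Matrix.cons_val_one, Matrix.cons_val] at h
  have h1 : t.basis.repr Z 1 = 0 := by rw [(t.repr _).1.2, g.symm, hZ, zero_div]
  rw [h1, zero_smul, add_zero] at h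
  set a := t.basis.repr Z 0
  set b := t.basis.repr Z 2
  set c := t.basis.repr Z 3
  have hq : g.form x Z Z = -t.chi2 / 2 * (b ^ 2 + c ^ 2) := by
    rw [← h]
    simp only [map_add, map_smul, _root_.add_apply, _root_.smul_apply, smul_eq_mul,
      g.symm x t.X (D x), g.symm x t.Y (D x), t.D_D, t.D_X, t.D_Y, t.X_X', t.Y_Y',
      g.symm x t.Y t.X, t.X_Y]
    ring
  by_cases hbc : b ^ 2 + c ^ 2 = 0
  · right
    have hb0 : b = 0 := by nlinarith [sq_nonneg b, sq_nonneg c]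
    have hc0 : c = 0 := by nlinarith [sq_nonneg b, sq_nonneg c]
    exact ⟨a, by rw [← h, hb0, hc0]; simp⟩
  · left
    rw [hq]
    have : 0 < b ^ 2 + c ^ 2 := lt_of_le_of_ne (by positivity) (Ne.symm hbc)
    nlinarith [mul_pos hpos this]

end NullTetrad

theorem contMDiff_epsSum (hn : IsLeviCivita g nabla) (hD : IsNullFoliation g v D)
    (t : ∀ x : M, NullTetrad g D x) :
    ContMDiff (𝓡 4) 𝓘(ℝ, ℝ) ∞ (fun y => (t y).epsSum nabla) := by
  intro x
  obtain ⟨N₀, hN₀⟩ := hD.exists_transverse x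
  set N : Π y : M, TangentSpace (𝓡 4) y := FiberBundle.extend E4 N₀
  have hNs : SmoothFieldAt N x := FiberBundle.contMDiffAt_extend (𝓡 4) E4 N₀
  have hNx : N x = N₀ := FiberBundle.extend_apply_self E4 N₀
  have hDs := hD.smoothFieldAt x
  have hDN := g.contMDiffAt_form hDs hNs
  have hAN := g.contMDiffAt_form ((hn.smoothEndoAt hD x).apply hDs) hNs
  have h0 : g.form x (D x) (N x) ≠ 0 := by rwa [hNx]
  refine (hAN.div₀ hDN h0).congr_of_eventuallyEq ?_
  filter_upwards [hDN.continuousAt.eventually_ne h0] with y hy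
  exact (t y).epsSum_eq hn hD hy

theorem contMDiff_rate (hn : IsLeviCivita g nabla) (hD : IsNullFoliation g v D)
    (t : ∀ x : M, NullTetrad g D x) :
    ContMDiff (𝓡 4) 𝓘(ℝ, ℝ) ∞ (fun y => (t y).rate nabla) := by
  intro x
  have h1 := contMDiff_epsSum hn hD t x
  have h2 := contMDiffAt_traceField (hn.smoothEndoAt hD x)
  have h3 : (fun y => (t y).rate nabla)
      = fun y => (1 / 2 : ℝ) * ((t y).epsSum nabla - traceField (nabla D) y) := by
    ext y
    rw [(t y).traceField_nabla hn hD]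
    ring
  rw [h3]
  exact contMDiffAt_const.mul (h1.sub h2)

/-- The Ricci curvature along the generators, in terms of the trace of `∇D`. -/
theorem ricci_self (hn : IsLeviCivita g nabla) (hD : IsNullFoliation g v D)
    (t : ∀ x : M, NullTetrad g D x) (x : M) :
    ricci nabla D D x = (t x).epsSum nabla * traceField (nabla D) x
      + along D (fun y => (t y).epsSum nabla) x - along D (traceField (nabla D)) x
      - LinearMap.trace ℝ _ ((nabla D x).toLinearMap ∘ₗ (nabla D x).toLinearMap) := by
  set b := Module.finBasis ℝ (TangentSpace (𝓡 4) x) with hb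
  have hDs := hD.smoothFieldAt x
  have hAs := hn.smoothEndoAt hD x
  have hk := (contMDiff_epsSum hn hD t x).mdifferentiableAt (by simp)
  have hXs : ∀ i, SmoothFieldAt (FiberBundle.extend E4 (b i) : Π y : M, TangentSpace (𝓡 4) y) x :=
    fun i => FiberBundle.contMDiffAt_extend (𝓡 4) E4 (b i)
  have hself : (fun y => nabla D y (D y)) = (fun y => (t y).epsSum nabla) • D :=
    funext fun y => (t y).nabla_self hn hD
  -- Torsion-freeness writes the bracket as `[X_i, D] = ∇_{X_i} D - ∇_D X_i`. Its second half
  -- completes `∇_D (∇D)` in the middle bracket, and its first half gives the square of `∇D`.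
  have hc : ∀ i, curvature nabla (FiberBundle.extend E4 (b i)) D D x
      = ((t x).epsSum nabla • nabla D x (b i)
          + mvfderiv (𝓡 4) (fun y => (t y).epsSum nabla) x (b i) • D x)
        - (nabla (fun y => nabla D y (FiberBundle.extend E4 (b i) y)) x (D x)
          - nabla D x (nabla (FiberBundle.extend E4 (b i)) x (D x)))
        - nabla D x (nabla D x (b i)) := by
    intro i
    have h4 := (nabla.torsion_eq_zero_iff.1 hn.torsion_free) (hXs i).fieldDiffAt hDs.fieldDiffAt
    simp only [FiberBundle.extend_apply_self] at h4
    rw [curvature, hself, nabla.isCovariantDerivativeOnUniv.leibniz hDs.fieldDiffAt hk, ← h4,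
      FiberBundle.extend_apply_self, map_sub]
    simp only [_root_.add_apply, _root_.smul_apply, ContinuousLinearMap.smulRight_apply]
    abel
  have htr : ∀ A : TangentSpace (𝓡 4) x →ₗ[ℝ] TangentSpace (𝓡 4) x,
      LinearMap.trace ℝ _ A = ∑ i, b.repr (A (b i)) i := by
    intro A
    rw [LinearMap.trace_eq_matrix_trace ℝ b]
    simp [Matrix.trace, LinearMap.toMatrix_apply]
  have hdk : ∑ i, mvfderiv (𝓡 4) (fun y => (t y).epsSum nabla) x (b i) * b.repr (D x) i
      = along D (fun y => (t y).epsSum nabla) x := by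
    have := congrArg (mvfderiv (𝓡 4) (fun y => (t y).epsSum nabla) x) (b.sum_repr (D x))
    simp only [map_sum, map_smul, smul_eq_mul] at this
    rw [along, ← this]
    exact Finset.sum_congr rfl fun i _ => mul_comm _ _
  have hcomm := sum_repr_eq_mvfderiv_traceField nabla hAs b (D x)
  have hr : ricci nabla D D x = ∑ i, b.repr (curvature nabla (FiberBundle.extend E4 (b i)) D D x) i :=
    rfl
  rw [hr, htr, traceField, htr, ← hdk]
  change _ = _ - mvfderiv (𝓡 4) (traceField (nabla D)) x (D x) - _
  rw [← hcomm]
  simp only [hc, map_sub, map_add, map_smul, Finsupp.sub_apply, Finsupp.add_apply,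
    Finsupp.smul_apply, smul_eq_mul, Finset.sum_sub_distrib, Finset.sum_add_distrib,
    Finset.mul_sum, LinearMap.comp_apply, ContinuousLinearMap.coe_coe]

/-- The focusing equation `Dρ = (ε + ε̄)ρ + ρ² + σσ̄ + Φ₀₀`. -/
theorem focusing (hn : IsLeviCivita g nabla) (hD : IsNullFoliation g v D)
    (t : ∀ x : M, NullTetrad g D x) (x : M) :
    along D (fun y => (t y).rate nabla) x = (t x).epsSum nabla * (t x).rate nabla
      + (t x).rate nabla ^ 2 + ‖(t x).sigma nabla‖ ^ 2 + Phi00 nabla D x := by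
  have h1 := ricci_self hn hD t x
  rw [(t x).trace_nabla_sq hn hD] at h1
  have h3 : traceField (nabla D)
      = (fun y => (t y).epsSum nabla) - (fun y => (2 : ℝ) * (t y).rate nabla) := by
    ext y
    exact (t y).traceField_nabla hn hD
  have hk := (contMDiff_epsSum hn hD t x).mdifferentiableAt (by simp)
  have hr := (contMDiff_rate hn hD t x).mdifferentiableAt (by simp)
  have h2 : along D (traceField (nabla D)) x = along D (fun y => (t y).epsSum nabla) x
      - 2 * along D (fun y => (t y).rate nabla) x := by
    have hr2 : MDifferentiableAt (𝓡 4) 𝓘(ℝ, ℝ) (fun y => (2 : ℝ) * (t y).rate nabla) x :=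
      mdifferentiableAt_const.mul hr
    rw [along, h3, mvfderiv_sub hk hr2]
    have := mvfderiv_mul (mdifferentiableAt_const (c := (2 : ℝ)) (I := 𝓡 4) (x := x)) hr
    rw [show (fun y => (2 : ℝ) * (t y).rate nabla) = (fun _ => (2 : ℝ)) * fun y => (t y).rate nabla
      from rfl, this, mvfderiv_const]
    simp [along]
  -- The terms `(ε + ε̄)²` and `D(ε + ε̄)` cancel.
  rw [Phi00, h1, h2, (t x).traceField_nabla hn hD]
  ring

end NullGeom

/-! ### Integral curves and local flows. -/

namespace NullGeom

variable {M : Type*} [TopologicalSpace M] [ChartedSpace E4 M] [IsManifold (𝓡 4) ∞ M]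

open Set

theorem IsSmoothField.contMDiff_one {D : Π x : M, TangentSpace (𝓡 4) x} (hD : IsSmoothField D) :
    ContMDiff (𝓡 4) (𝓡 4).tangent 1 (fun x => (⟨x, D x⟩ : TangentBundle (𝓡 4) M)) :=
  ContMDiff.of_le hD (by norm_cast)

theorem hasDerivWithinAt_comp_curve {D : Π x : M, TangentSpace (𝓡 4) x} {γ : ℝ → M} {s : Set ℝ}
    (hγ : IsMIntegralCurveOn (I := 𝓡 4) γ D s) {u : ℝ} (hu : u ∈ s) {f : M → ℝ}
    (hf : MDifferentiableAt (𝓡 4) 𝓘(ℝ, ℝ) f (γ u)) :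
    HasDerivWithinAt (f ∘ γ) (along D f (γ u)) s u := by
  obtain ⟨L, hL, hL1⟩ : ∃ L : ℝ →L[ℝ] ℝ, HasFDerivWithinAt (f ∘ γ) L s u ∧
      L 1 = along D f (γ u) := by
    refine ⟨_, (hf.hasMFDerivAt.comp_hasMFDerivWithinAt u (hγ u hu)).hasFDerivWithinAt, ?_⟩
    change (mfderiv (𝓡 4) 𝓘(ℝ, ℝ) f (γ u)) ((1 : ℝ) • (D (γ u))) = _
    rw [one_smul]
    rfl
  exact hL1 ▸ hL.hasDerivWithinAt

theorem contDiffAt_chartField {D : Π x : M, TangentSpace (𝓡 4) x} (hD : IsSmoothField D) (x : M) :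
    ContDiffAt ℝ 1 (chartField x D) (extChartAt (𝓡 4) x x) := by
  have h := VectorField.contMDiffWithinAt_mpullbackWithin_extChartAt_symm (I := 𝓡 4) (n := ∞)
    (m := 1) (s := univ) (x := x) (V := D) (hD.contMDiff_one.contMDiffAt).contMDiffWithinAt
    uniqueMDiffOn_univ (mem_univ _) (by norm_cast)
  have h2 := contMDiffWithinAt_vectorSpace_iff_contDiffWithinAt.1 h
  refine h2.contDiffAt ?_
  rw [preimage_univ, inter_univ]
  exact extChartAt_target_mem_nhds (I := 𝓡 4) x

theorem hasMFDerivAt_chart_symm_comp {D : Π x : M, TangentSpace (𝓡 4) x} {x : M} {α : ℝ → E4}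
    {u : ℝ} (hα : HasDerivAt α (chartField x D (α u)) u)
    (hu : α u ∈ (extChartAt (𝓡 4) x).target) :
    HasMFDerivAt 𝓘(ℝ, ℝ) (𝓡 4) ((extChartAt (𝓡 4) x).symm ∘ α) u
      ((1 : ℝ →L[ℝ] ℝ).smulRight (D ((extChartAt (𝓡 4) x).symm (α u)))) := by
  set φ := extChartAt (𝓡 4) x with hφ
  have hS := isInvertible_mfderivWithin_extChartAt_symm (I := 𝓡 4) hu
  have hd : MDifferentiableWithinAt 𝓘(ℝ, E4) (𝓡 4) φ.symm (Set.range (𝓡 4)) (α u) :=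
    mdifferentiableWithinAt_extChartAt_symm hu
  have h1 : HasMFDerivAt 𝓘(ℝ, ℝ) 𝓘(ℝ, E4) α u
      ((1 : ℝ →L[ℝ] ℝ).smulRight (chartField x D (α u))) := by
    have := hα.hasFDerivAt.hasMFDerivAt
    rw [← ContinuousLinearMap.smulRight_one_eq_toSpanSingleton] at this
    exact this
  have h2 := hasMFDerivWithinAt_univ.1 (HasMFDerivWithinAt.comp u hd.hasMFDerivWithinAt
    (hasMFDerivWithinAt_univ.2 h1) (fun s _ => by simp))
  have e : (mfderivWithin 𝓘(ℝ, E4) (𝓡 4) φ.symm (Set.range (𝓡 4)) (α u)).comp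
      ((1 : ℝ →L[ℝ] ℝ).smulRight (chartField x D (α u)))
      = ((1 : ℝ →L[ℝ] ℝ).smulRight (D (φ.symm (α u)))) := by
    refine ContinuousLinearMap.ext fun s => ?_
    change (mfderivWithin 𝓘(ℝ, E4) (𝓡 4) φ.symm (Set.range (𝓡 4)) (α u))
      (s • ((mfderivWithin 𝓘(ℝ, E4) (𝓡 4) φ.symm (Set.range (𝓡 4)) (α u)).inverse
        (D (φ.symm (α u))))) = s • D (φ.symm (α u))
    rw [map_smul, hS.self_apply_inverse]
  rw [← e]
  exact h2

/-- A continuous local flow of `D`, defined for the times in `J`, with initial points in `W`. -/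
structure IsFlowOn (D : Π x : M, TangentSpace (𝓡 4) x) (W : Set M) (J : Set ℝ)
    (Φ : M → ℝ → M) : Prop where
  zero : ∀ q ∈ W, Φ q 0 = q
  curve : ∀ q ∈ W, IsMIntegralCurveOn (I := 𝓡 4) (Φ q) D J
  cont : ContinuousOn (Function.uncurry Φ) (W ×ˢ J)

theorem IsFlowOn.mono {D : Π x : M, TangentSpace (𝓡 4) x} {W W' : Set M} {J J' : Set ℝ}
    {Φ : M → ℝ → M} (h : IsFlowOn D W J Φ) (hW : W' ⊆ W) (hJ : J' ⊆ J) : IsFlowOn D W' J' Φ :=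
  ⟨fun q hq => h.zero q (hW hq), fun q hq => (h.curve q (hW hq)).mono hJ,
    h.cont.mono (prod_mono hW hJ)⟩

/-- Picard–Lindelöf with continuous dependence on the initial value; continuity at `(x, 0)` allows
shrinking until trajectories stay in `T`, which will be the target of a chart. -/
theorem exists_flow_normed {E : Type*} [NormedAddCommGroup E] [NormedSpace ℝ E]
    [CompleteSpace E] {f : E → E} {x : E} (hf : ContDiffAt ℝ 1 f x) {T : Set E}
    (hT : T ∈ 𝓝 x) : ∃ (A : Set E) (δ : ℝ) (α : E × ℝ → E), IsOpen A ∧ x ∈ A ∧ 0 < δ ∧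
      (∀ z ∈ A, α (z, 0) = z) ∧
      (∀ z ∈ A, ∀ s ∈ Ioo (-δ) δ, HasDerivAt (fun s => α (z, s)) (f (α (z, s))) s ∧
        α (z, s) ∈ T) ∧ ContinuousOn α (A ×ˢ Ioo (-δ) δ) := by
  obtain ⟨ε, hε, a, r, L, K, hr, hpl⟩ := IsPicardLindelof.of_contDiffAt_one hf
  obtain ⟨α, hα1, hα2⟩ :=
    (hpl 0).exists_forall_mem_closedBall_eq_hasDerivWithinAt_continuousOn
  have hnb : Metric.closedBall x (r : ℝ) ×ˢ Icc (0 - ε) (0 + ε) ∈ 𝓝 ((x, 0) : E × ℝ) :=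
    prod_mem_nhds (Metric.closedBall_mem_nhds _ (by exact_mod_cast hr))
      (Icc_mem_nhds (by linarith) (by linarith))
  have hc : ContinuousAt α (x, 0) := hα2.continuousAt hnb
  have h0 : α (x, 0) = x := (hα1 x (Metric.mem_closedBall_self r.2)).1
  have ht : α ⁻¹' T ∈ 𝓝 ((x, 0) : E × ℝ) := by
    apply hc.preimage_mem_nhds
    rwa [h0]
  obtain ⟨A, hA, B, hB, hAB⟩ := mem_nhds_prod_iff.1 (Filter.inter_mem hnb ht)
  obtain ⟨A', hA'A, hA'o, hxA'⟩ := mem_nhds_iff.1 hA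
  obtain ⟨δ, hδ, hδB⟩ := Metric.mem_nhds_iff.1 hB
  rw [Real.ball_eq_Ioo, zero_sub, zero_add] at hδB
  have key : ∀ z ∈ A', ∀ s ∈ Ioo (-δ) δ, (z ∈ Metric.closedBall x (r : ℝ) ∧
      s ∈ Icc (0 - ε) (0 + ε)) ∧ α (z, s) ∈ T := fun z hz s hs =>
    hAB (mk_mem_prod (hA'A hz) (hδB hs))
  have h00 : (0 : ℝ) ∈ Ioo (-δ) δ := ⟨by linarith, hδ⟩
  refine ⟨A', δ, α, hA'o, hxA', hδ, fun z hz => (hα1 z (key z hz 0 h00).1.1).1,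
    fun z hz s hs => ⟨?_, (key z hz s hs).2⟩,
    hα2.mono (prod_subset_iff.2 fun z hz s hs => (key z hz s hs).1)⟩
  have hIoo : Ioo (-δ) δ ⊆ Icc (0 - ε) (0 + ε) := fun s hs => (key z hz s hs).1.2
  exact ((hα1 z (key z hz s hs).1.1).2 s (hIoo hs)).hasDerivAt
    (Filter.mem_of_superset (Ioo_mem_nhds hs.1 hs.2) hIoo)

theorem exists_local_flow {D : Π x : M, TangentSpace (𝓡 4) x} (hD : IsSmoothField D) (x : M) :
    ∃ (W : Set M) (δ : ℝ) (Φ : M → ℝ → M), IsOpen W ∧ x ∈ W ∧ 0 < δ ∧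
      IsFlowOn D W (Ioo (-δ) δ) Φ := by
  obtain ⟨A, δ, α, hA, hxA, hδ, h0, hd, hc⟩ := exists_flow_normed (contDiffAt_chartField hD x)
    (extChartAt_target_mem_nhds (I := 𝓡 4) x)
  refine ⟨(extChartAt (𝓡 4) x).source ∩ extChartAt (𝓡 4) x ⁻¹' A, δ,
    fun q s => (extChartAt (𝓡 4) x).symm (α (extChartAt (𝓡 4) x q, s)),
    (continuousOn_extChartAt x).isOpen_inter_preimage (isOpen_extChartAt_source x) hA,
    ⟨mem_extChartAt_source x, hxA⟩, hδ, ⟨fun q hq => ?_, fun q hq s hs => ?_, ?_⟩⟩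
  · rw [h0 _ hq.2]
    exact (extChartAt (𝓡 4) x).left_inv hq.1
  · exact (hasMFDerivAt_chart_symm_comp (hd _ hq.2 s hs).1
      (hd _ hq.2 s hs).2).hasMFDerivWithinAt
  · have c1 : ContinuousOn (fun p : M × ℝ => α (extChartAt (𝓡 4) x p.1, p.2))
        (((extChartAt (𝓡 4) x).source ∩ extChartAt (𝓡 4) x ⁻¹' A) ×ˢ Ioo (-δ) δ) :=
      hc.comp (((continuousOn_extChartAt x).comp continuousOn_fst fun p hp => hp.1.1).prodMk
        continuousOn_snd) fun p hp => ⟨hp.1.2, hp.2⟩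
    exact (continuousOn_extChartAt_symm x).comp c1 fun p hp => (hd _ hp.1.2 _ hp.2).2

section Unique

variable [T2Space M]

/-- Uniqueness of integral curves is applied on open intervals, whereas `γ` starts at 0. So `γ` is
prolonged to negative times by `β`, the one-sided derivatives at 0 fit together, and continuity
yields the end point `T`. -/
theorem eqOn_of_curves {D : Π x : M, TangentSpace (𝓡 4) x} (hD : IsSmoothField D) {γ β : ℝ → M}
    {a b T : ℝ} (hT : 0 ≤ T) (hγ : IsMIntegralCurveOn (I := 𝓡 4) γ D (Icc 0 T)) (ha : a < 0)
    (hb : T < b) (hβ : IsMIntegralCurveOn (I := 𝓡 4) β D (Ioo a b)) (h0 : γ 0 = β 0) :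
    EqOn γ β (Icc 0 T) := by
  rcases hT.eq_or_lt with rfl | hT
  · intro s hs
    rw [Icc_self] at hs
    rw [mem_singleton_iff.1 hs, h0]
  classical
  set γ' : ℝ → M := fun s => if s < 0 then β s else γ s with hγ'
  have hpos : ∀ s, 0 ≤ s → γ' s = γ s := fun s hs => if_neg (not_lt.2 hs)
  have hneg : ∀ s, s ≤ 0 → γ' s = β s := fun s hs => by
    rcases hs.lt_or_eq with h | rfl
    · exact if_pos h
    · rw [hpos 0 le_rfl, h0]
  have hint : IsMIntegralCurveOn (I := 𝓡 4) γ' D (Ioo a T) := by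
    intro s hs
    apply HasMFDerivAt.hasMFDerivWithinAt
    rcases lt_trichotomy s 0 with h | rfl | h
    · rw [hneg s h.le]
      refine ((hβ s ⟨hs.1, h.trans (hT.trans hb)⟩).hasMFDerivAt
        (Ioo_mem_nhds hs.1 (h.trans (hT.trans hb)))).congr_of_eventuallyEq ?_
      filter_upwards [Iio_mem_nhds h] with y hy using hneg y (le_of_lt hy)
    · have hm : Iic (0 : ℝ) ∪ Ici 0 = univ := Iic_union_Ici
      refine hasMFDerivWithinAt_univ.1 ?_
      refine hm ▸ HasMFDerivWithinAt.union ?_ ?_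
      · rw [hneg 0 le_rfl]
        exact ((hβ 0 ⟨ha, hT.trans hb⟩).hasMFDerivAt
          (Ioo_mem_nhds ha (hT.trans hb))).hasMFDerivWithinAt.congr_of_eventuallyEq
          (Filter.eventually_of_mem self_mem_nhdsWithin fun y hy => hneg y hy) (hneg 0 le_rfl)
      · rw [hpos 0 le_rfl]
        have h1 : HasMFDerivWithinAt 𝓘(ℝ, ℝ) (𝓡 4) γ (Ici 0) 0 _ :=
          (hγ 0 ⟨le_rfl, hT.le⟩).mono_of_mem_nhdsWithin (Icc_mem_nhdsGE hT)
        exact h1.congr_of_eventuallyEq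
          (Filter.eventually_of_mem self_mem_nhdsWithin fun y hy => hpos y hy) (hpos 0 le_rfl)
    · rw [hpos s h.le]
      refine ((hγ s ⟨h.le, hs.2.le⟩).hasMFDerivAt
        (Icc_mem_nhds h hs.2)).congr_of_eventuallyEq ?_
      filter_upwards [Ioi_mem_nhds h] with y hy using hpos y (le_of_lt hy)
  have he := isMIntegralCurveOn_Ioo_eqOn_of_contMDiff_boundaryless (t₀ := 0) ⟨ha, hT⟩
    hD.contMDiff_one hint (hβ.mono (Ioo_subset_Ioo_right hb.le)) (hneg 0 le_rfl)
  have he' : EqOn γ β (Ioo 0 T) := fun s hs => by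
    rw [← hpos s hs.1.le]
    exact he ⟨ha.trans hs.1, hs.2⟩
  have hsub : Icc 0 T ⊆ Ioo a b := fun s hs => ⟨ha.trans_le hs.1, hs.2.trans_lt hb⟩
  exact he'.of_subset_closure hγ.continuousOn (hβ.continuousOn.mono hsub) Ioo_subset_Icc_self
    (by rw [closure_Ioo hT.ne])

end Unique

end NullGeom

/-! ### Flows along compact pieces of integral curves. -/

namespace NullGeom

variable {M : Type*} [TopologicalSpace M] [ChartedSpace E4 M] [IsManifold (𝓡 4) ∞ M] [T2Space M]

open Set

theorem curve_congr {D : Π x : M, TangentSpace (𝓡 4) x} {γ β : ℝ → M} {J : Set ℝ} (hJ : IsOpen J)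
    (hβ : IsMIntegralCurveOn (I := 𝓡 4) β D J) (h : EqOn γ β J) :
    IsMIntegralCurveOn (I := 𝓡 4) γ D J := by
  intro s hs
  apply HasMFDerivAt.hasMFDerivWithinAt
  rw [h hs]
  exact ((hβ s hs).hasMFDerivAt (hJ.mem_nhds hs)).congr_of_eventuallyEq
    (Filter.mem_of_superset (hJ.mem_nhds hs) h)

theorem curve_union {D : Π x : M, TangentSpace (𝓡 4) x} {γ : ℝ → M} {J K : Set ℝ} (hJ : IsOpen J)
    (hK : IsOpen K) (h₁ : IsMIntegralCurveOn (I := 𝓡 4) γ D J)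
    (h₂ : IsMIntegralCurveOn (I := 𝓡 4) γ D K) : IsMIntegralCurveOn (I := 𝓡 4) γ D (J ∪ K) := by
  rintro s (hs | hs)
  · exact ((h₁ s hs).hasMFDerivAt (hJ.mem_nhds hs)).hasMFDerivWithinAt
  · exact ((h₂ s hs).hasMFDerivAt (hK.mem_nhds hs)).hasMFDerivWithinAt

/-- Follow `Φ` up to time `u`, then `θ`. By uniqueness the two agree around time `u`, so on each of
two overlapping open time intervals the glued map is one of them, and being a continuous flow is a
local matter. -/
theorem IsFlowOn.extend {D : Π x : M, TangentSpace (𝓡 4) x} (hD : IsSmoothField D) {W W' : Set M}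
    {Φ θ : M → ℝ → M} {η δ u u' : ℝ} (hη : 0 < η) (hδ : 0 < δ) (hu : 0 ≤ u)
    (hW : IsOpen W) (hW' : IsOpen W')
    (hΦ : IsFlowOn D W (Ioo (-η) (u + η)) Φ) (hθ : IsFlowOn D W' (Ioo (-δ) δ) θ)
    (hu' : u' < u + δ) {p : M} (hp : p ∈ W) (hpu : Φ p u ∈ W') :
    ∃ (W₁ : Set M) (η₁ : ℝ) (Φ' : M → ℝ → M), IsOpen W₁ ∧ p ∈ W₁ ∧ 0 < η₁ ∧
      IsFlowOn D W₁ (Ioo (-η₁) (u' + η₁)) Φ' := by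
  classical
  have hum : u ∈ Ioo (-η) (u + η) := ⟨by linarith, by linarith⟩
  have hcu : ContinuousOn (fun q => Φ q u) W :=
    hΦ.cont.comp (f := fun q => (q, u)) (by fun_prop) fun q hq => ⟨hq, hum⟩
  set W₁ := W ∩ (fun q => Φ q u) ⁻¹' W' with hW₁
  have hW₁o : IsOpen W₁ := hcu.isOpen_inter_preimage hW hW'
  set e := min η δ with he
  have he0 : 0 < e := lt_min hη hδ
  have heη : e ≤ η := min_le_left _ _
  have heδ : e ≤ δ := min_le_right _ _
  have hcurveB : ∀ q ∈ W₁, IsMIntegralCurveOn (I := 𝓡 4) (θ (Φ q u) ∘ (· + -u)) D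
      (Ioo (u - e) (u + δ)) := fun q hq =>
    ((hθ.curve _ hq.2).comp_add (-u)).mono fun s hs => by
      change s + -u ∈ Ioo (-δ) δ
      exact ⟨by linarith [hs.1], by linarith [hs.2]⟩
  have hover : ∀ q ∈ W₁, EqOn (Φ q) (θ (Φ q u) ∘ (· + -u)) (Ioo (u - e) (u + e)) := by
    intro q hq
    refine isMIntegralCurveOn_Ioo_eqOn_of_contMDiff_boundaryless (t₀ := u)
      ⟨by linarith, by linarith⟩ hD.contMDiff_one
      ((hΦ.curve q hq.1).mono (Ioo_subset_Ioo (by linarith) (by linarith)))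
      ((hcurveB q hq).mono (Ioo_subset_Ioo le_rfl (by linarith))) ?_
    simp [hθ.zero _ hq.2]
  set Φ' : M → ℝ → M := fun q s => if s ≤ u then Φ q s else (θ (Φ q u) ∘ (· + -u)) s with hΦ'
  have hA : ∀ q ∈ W₁, EqOn (Φ' q) (Φ q) (Ioo (-η) (u + e)) := by
    intro q hq s hs
    by_cases h : s ≤ u
    · exact if_pos h
    · exact (if_neg h).trans (hover q hq ⟨by linarith, hs.2⟩).symm
  have hB : ∀ q ∈ W₁, EqOn (Φ' q) (θ (Φ q u) ∘ (· + -u)) (Ioo (u - e) (u + δ)) := by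
    intro q hq s hs
    by_cases h : s ≤ u
    · exact (if_pos h).trans (hover q hq ⟨hs.1, by linarith⟩)
    · exact if_neg h
  set η₁ := min η (u + δ - u') with hη₁
  have hsub : Ioo (-η₁) (u' + η₁) ⊆ Ioo (-η) (u + e) ∪ Ioo (u - e) (u + δ) := by
    intro s hs
    have h1 : η₁ ≤ η := min_le_left _ _
    have h2 : η₁ ≤ u + δ - u' := min_le_right _ _
    rcases lt_or_ge s (u + e) with h | h
    · exact Or.inl ⟨by linarith [hs.1], h⟩
    · exact Or.inr ⟨by linarith, by linarith [hs.2]⟩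
  refine ⟨W₁, η₁, Φ', hW₁o, ⟨hp, hpu⟩, lt_min hη (by linarith), ?_⟩
  have hbig : IsFlowOn D W₁ (Ioo (-η) (u + e) ∪ Ioo (u - e) (u + δ)) Φ' := by
    refine ⟨fun q hq => ?_, fun q hq => ?_, ?_⟩
    · rw [hA q hq ⟨by linarith, by linarith⟩, hΦ.zero q hq.1]
    · exact curve_union isOpen_Ioo isOpen_Ioo
        (curve_congr isOpen_Ioo ((hΦ.curve q hq.1).mono (Ioo_subset_Ioo_right (by linarith)))
          (hA q hq)) (curve_congr isOpen_Ioo (hcurveB q hq) (hB q hq))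
    · rw [prod_union]
      refine ContinuousOn.union_of_isOpen ?_ ?_ (hW₁o.prod isOpen_Ioo) (hW₁o.prod isOpen_Ioo)
      · refine (hΦ.cont.mono (prod_mono inter_subset_left
          (Ioo_subset_Ioo_right (by linarith)))).congr fun z hz => ?_
        exact hA z.1 hz.1 hz.2
      · have : ContinuousOn (fun z : M × ℝ => Function.uncurry θ (Φ z.1 u, z.2 + -u))
            (W₁ ×ˢ Ioo (u - e) (u + δ)) := by
          refine hθ.cont.comp (ContinuousOn.prodMk ?_ (by fun_prop)) ?_
          · exact hcu.comp continuousOn_fst fun z hz => hz.1.1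
          · intro z hz
            exact ⟨hz.1.2, by linarith [hz.2.1], by linarith [hz.2.2]⟩
        exact this.congr fun z hz => hB z.1 hz.1 hz.2
  exact hbig.mono subset_rfl hsub

/-- Near the initial point of an integral curve on a compact interval, the flow is defined and
continuous on a slightly larger interval. -/
theorem exists_flow_of_curve {D : Π x : M, TangentSpace (𝓡 4) x} (hD : IsSmoothField D)
    {γ : ℝ → M} {T : ℝ} (hT : 0 ≤ T) (hγ : IsMIntegralCurveOn (I := 𝓡 4) γ D (Icc 0 T)) :
    ∃ (W : Set M) (η : ℝ) (Φ : M → ℝ → M), IsOpen W ∧ γ 0 ∈ W ∧ 0 < η ∧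
      IsFlowOn D W (Ioo (-η) (T + η)) Φ := by
  have hK : IsCompact (γ '' Icc 0 T) := isCompact_Icc.image_of_continuousOn hγ.continuousOn
  -- A lifetime `δ` common to the local flows at all points of the compact curve.
  obtain ⟨δ, hδ, hloc⟩ : ∃ δ > 0, ∀ x ∈ γ '' Icc 0 T, ∃ (W : Set M) (θ : M → ℝ → M),
      IsOpen W ∧ x ∈ W ∧ IsFlowOn D W (Ioo (-δ) δ) θ := by
    refine hK.induction_on (p := fun A => ∃ δ > 0, ∀ x ∈ A, ∃ (W : Set M) (θ : M → ℝ → M),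
      IsOpen W ∧ x ∈ W ∧ IsFlowOn D W (Ioo (-δ) δ) θ) ⟨1, one_pos, by simp⟩ ?_ ?_ ?_
    · rintro A B hAB ⟨δ, hδ, h⟩
      exact ⟨δ, hδ, fun x hx => h x (hAB hx)⟩
    · rintro A B ⟨δ, hδ, h⟩ ⟨δ', hδ', h'⟩
      refine ⟨min δ δ', lt_min hδ hδ', ?_⟩
      rintro x (hx | hx)
      · obtain ⟨W, θ, hW, hxW, hθ⟩ := h x hx
        exact ⟨W, θ, hW, hxW, hθ.mono subset_rfl
          (Ioo_subset_Ioo (neg_le_neg (min_le_left _ _)) (min_le_left _ _))⟩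
      · obtain ⟨W, θ, hW, hxW, hθ⟩ := h' x hx
        exact ⟨W, θ, hW, hxW, hθ.mono subset_rfl
          (Ioo_subset_Ioo (neg_le_neg (min_le_right _ _)) (min_le_right _ _))⟩
    · intro x _
      obtain ⟨W, δ, θ, hW, hxW, hδ, hθ⟩ := exists_local_flow hD x
      exact ⟨W, mem_nhdsWithin_of_mem_nhds (hW.mem_nhds hxW), δ, hδ,
        fun y hy => ⟨W, θ, hW, hy, hθ⟩⟩
  -- Advance in steps of `δ/2`: each local flow lasts for `δ`, which leaves a margin beyond the time
  -- reached.
  have key : ∀ n : ℕ, ∀ u ∈ Icc 0 T, u ≤ n * (δ / 2) → ∃ (W : Set M) (η : ℝ) (Φ : M → ℝ → M),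
      IsOpen W ∧ γ 0 ∈ W ∧ 0 < η ∧ IsFlowOn D W (Ioo (-η) (u + η)) Φ := by
    intro n
    induction n with
    | zero =>
      intro u hu hu0
      have : u = 0 := le_antisymm (by simpa using hu0) hu.1
      subst this
      obtain ⟨W, θ, hW, hxW, hθ⟩ := hloc (γ 0) ⟨0, hu, rfl⟩
      exact ⟨W, δ, θ, hW, hxW, hδ, by simpa using hθ⟩
    | succ n ih =>
      intro u hu hun
      set u₀ := max 0 (u - δ / 2) with hu₀
      have h0 : 0 ≤ u₀ := le_max_left _ _
      have h0u : u₀ ≤ u := max_le hu.1 (by linarith)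
      have hu0 : u < u₀ + δ := by linarith [le_max_right 0 (u - δ / 2)]
      have hu₀T : u₀ ∈ Icc 0 T := ⟨h0, h0u.trans hu.2⟩
      push_cast at hun
      obtain ⟨W, η, Φ, hW, hγW, hη, hΦ⟩ := ih u₀ hu₀T
        (max_le (by positivity) (by linarith))
      obtain ⟨W', θ, hW', hxW', hθ⟩ := hloc (γ u₀) ⟨u₀, hu₀T, rfl⟩
      have heq : γ u₀ = Φ (γ 0) u₀ := eqOn_of_curves hD h0 (hγ.mono (Icc_subset_Icc_right hu₀T.2))
        (neg_lt_zero.2 hη) (by linarith) (hΦ.curve _ hγW) (hΦ.zero _ hγW).symm ⟨h0, le_rfl⟩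
      exact hΦ.extend hD hη hδ h0 hW hW' hθ hu0 hγW (heq ▸ hxW')
  obtain ⟨n, hn⟩ := exists_nat_ge (T / (δ / 2))
  exact key n T ⟨hT, le_rfl⟩ ((div_le_iff₀ (by positivity)).1 hn)

theorem IsSmoothField.neg {D : Π x : M, TangentSpace (𝓡 4) x} (hD : IsSmoothField D) :
    IsSmoothField (-D) :=
  ContMDiff.neg_section hD

theorem IsFlowOn.reverse {D : Π x : M, TangentSpace (𝓡 4) x} {W : Set M} {a b : ℝ}
    {Φ : M → ℝ → M} (h : IsFlowOn (-D) W (Ioo a b) Φ) :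
    IsFlowOn D W (Ioo (-b) (-a)) (fun q s => Φ q (-s)) := by
  refine ⟨fun q hq => by rw [neg_zero, h.zero q hq], fun q hq => ?_, ?_⟩
  · have := (h.curve q hq).comp_mul (-1)
    have e1 : Φ q ∘ (fun x => x * (-1 : ℝ)) = fun s => Φ q (-s) := by
      ext s; simp
    have e2 : (-1 : ℝ) • (-D) = D := by simp
    rw [e1, e2] at this
    refine this.mono fun s hs => ?_
    change s * -1 ∈ Ioo a b
    exact ⟨by linarith [hs.2], by linarith [hs.1]⟩
  · refine h.cont.comp (f := fun z : M × ℝ => (z.1, -z.2)) (by fun_prop) fun z hz => ?_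
    exact ⟨hz.1, by linarith [hz.2.2], by linarith [hz.2.1]⟩

/-- The backward flow near the end point of an integral curve. -/
theorem exists_flow_back_of_curve {D : Π x : M, TangentSpace (𝓡 4) x} (hD : IsSmoothField D)
    {γ : ℝ → M} {T : ℝ} (hT : 0 ≤ T) (hγ : IsMIntegralCurveOn (I := 𝓡 4) γ D (Icc 0 T)) :
    ∃ (W : Set M) (η : ℝ) (Φ : M → ℝ → M), IsOpen W ∧ γ T ∈ W ∧ 0 < η ∧
      IsFlowOn D W (Ioo (-(T + η)) η) Φ ∧ Φ (γ T) (-T) = γ 0 := by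
  have h1 : IsMIntegralCurveOn (I := 𝓡 4) (fun s => γ (T - s)) (-D) (Icc 0 T) := by
    have := (hγ.comp_add T).comp_mul (-1)
    have e1 : (γ ∘ fun x => x + T) ∘ (fun x => x * (-1 : ℝ)) = fun s => γ (T - s) := by
      ext s; simp [sub_eq_neg_add]
    have e2 : (-1 : ℝ) • D = -D := by simp
    rw [e1, e2] at this
    refine this.mono fun s hs => ?_
    change s * -1 + T ∈ Icc 0 T
    exact ⟨by linarith [hs.2], by linarith [hs.1]⟩
  obtain ⟨W, η, Φ, hW, hγW, hη, hΦ⟩ := exists_flow_of_curve hD.neg hT h1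
  rw [sub_zero] at hγW
  have h2 := eqOn_of_curves hD.neg hT h1 (neg_lt_zero.2 hη) (by linarith) (hΦ.curve _ hγW)
    (by rw [hΦ.zero _ hγW, sub_zero]) (right_mem_Icc.2 hT)
  refine ⟨W, η, fun q s => Φ q (-s), hW, hγW, hη, by simpa using hΦ.reverse, ?_⟩
  simpa using h2.symm

end NullGeom

/-! ### Level sets of submersions. -/

namespace NullGeom

section Normed

variable {E F F' : Type*} [NormedAddCommGroup E] [NormedSpace ℝ E] [FiniteDimensional ℝ E]
  [NormedAddCommGroup F] [NormedSpace ℝ F] [FiniteDimensional ℝ F]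
  [NormedAddCommGroup F'] [NormedSpace ℝ F'] [FiniteDimensional ℝ F']

/-- A function vanishing on a level set has differential zero on its tangent space. -/
theorem fderiv_eq_zero_of_vanish {f : E → F} {ψ : E → ℝ} {f' : E →L[ℝ] F} {ψ' : E →L[ℝ] ℝ} {a : E}
    (hf : HasStrictFDerivAt f f' a) (hψ : HasStrictFDerivAt ψ ψ' a)
    (hsurj : Function.Surjective f') (h0 : f a = 0) (h : ∀ᶠ y in 𝓝 a, f y = 0 → ψ y = 0)
    {X : E} (hX : f' X = 0) : ψ' X = 0 := by
  -- `ψ` is constant on the level set, hence extremal at `a`, and Lagrange multipliers apply. A zero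
  -- multiplier `Λ₀` is excluded by surjectivity of `f'`.
  have hext : IsLocalExtrOn ψ {y | f y = f a} a := by
    left
    have h1 : ψ a = 0 := h.self_of_nhds h0
    filter_upwards [mem_nhdsWithin_of_mem_nhds h, self_mem_nhdsWithin] with y hy hy'
    rw [h1, hy (by rw [← h0]; exact hy')]
  have : CompleteSpace E := FiniteDimensional.complete ℝ E
  have : CompleteSpace F := FiniteDimensional.complete ℝ F
  obtain ⟨Λ, Λ₀, hne, hΛ⟩ := hext.exists_linear_map_of_hasStrictFDerivAt hf hψ
  by_cases h0 : Λ₀ = 0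
  · exfalso
    apply hne
    ext z
    · obtain ⟨x, rfl⟩ := hsurj z
      simpa [h0] using hΛ x
    · simp [h0]
  · have := hΛ X
    rw [hX, map_zero, zero_add, smul_eq_mul] at this
    exact (mul_eq_zero.1 this).resolve_left h0

/-- Composing with a linear left inverse of `H'` makes the derivative the identity; the inverse
function theorem gives injectivity of the composite. -/
theorem eventually_injOn_of_injective {H : E → F} {H' : E →L[ℝ] F} {a : E}
    (hH : HasStrictFDerivAt H H' a) (hinj : Function.Injective H') :
    ∃ s ∈ 𝓝 a, Set.InjOn H s := by
  have : CompleteSpace E := FiniteDimensional.complete ℝ E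
  obtain ⟨L, hL⟩ := (H' : E →ₗ[ℝ] F).exists_leftInverse_of_injective (LinearMap.ker_eq_bot.2 hinj)
  have h1 := (LinearMap.toContinuousLinearMap L).hasStrictFDerivAt (x := H a)
  have h2 := h1.comp a hH
  have e : (LinearMap.toContinuousLinearMap L).comp H'
      = ((ContinuousLinearEquiv.refl ℝ E : E ≃L[ℝ] E) : E →L[ℝ] E) := by
    ext x
    exact LinearMap.congr_fun hL x
  rw [e] at h2
  refine ⟨_, h2.toOpenPartialHomeomorph _ |>.open_source.mem_nhds
    h2.mem_toOpenPartialHomeomorph_source, fun x hx y hy hxy => ?_⟩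
  apply (h2.toOpenPartialHomeomorph _).injOn hx hy
  rw [h2.toOpenPartialHomeomorph_coe]
  simp [hxy]

/-- Two systems of equations with the same tangent space define the same set germ, if one
of the sets contains the other one. -/
theorem eventually_zero_of_ker_le {f : E → F} {h : E → F'} {f' : E →L[ℝ] F} {h' : E →L[ℝ] F'}
    {a : E} (hf : HasStrictFDerivAt f f' a) (hh : HasStrictFDerivAt h h' a)
    (hsurj : Function.Surjective f') (h0 : f a = 0) (hker : ∀ X, h' X = 0 → f' X = 0)
    (himp : ∀ᶠ y in 𝓝 a, f y = 0 → h y = 0) : ∀ᶠ y in 𝓝 a, h y = 0 → f y = 0 := by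
  have : CompleteSpace E := FiniteDimensional.complete ℝ E
  have : CompleteSpace F := FiniteDimensional.complete ℝ F
  set K := LinearMap.ker (f' : E →ₗ[ℝ] F) with hK
  have : CompleteSpace K := FiniteDimensional.complete ℝ K
  obtain ⟨P₀, hP₀⟩ := K.subtype.exists_leftInverse_of_injective (Submodule.ker_subtype K)
  -- With a projection `P` onto `ker f'`, the map `(f, P)` is a submersion and, by `hker`, `(h, P)`
  -- is an immersion.
  set P : E →L[ℝ] K := LinearMap.toContinuousLinearMap P₀ with hP
  have hPk : ∀ k : K, P (k : E) = k := fun k => LinearMap.congr_fun hP₀ k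
  have hGd : HasStrictFDerivAt (fun x => (f x, P x)) (f'.prod P) a :=
    hf.prodMk P.hasStrictFDerivAt
  have hHd : HasStrictFDerivAt (fun x => (h x, P x)) (h'.prod P) a :=
    hh.prodMk P.hasStrictFDerivAt
  have hGs : Function.Surjective (f'.prod P) := by
    rintro ⟨z, k⟩
    obtain ⟨e, rfl⟩ := hsurj z
    refine ⟨e - P e + k, ?_⟩
    have h1 : ∀ k : K, f' (k : E) = 0 := fun k => k.2
    simp [map_sub, map_add, h1, hPk]
  have hHi : Function.Injective (h'.prod P) := by
    rw [injective_iff_map_eq_zero]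
    intro X hX
    rw [ContinuousLinearMap.prod_apply, Prod.mk_eq_zero] at hX
    have hk : X ∈ K := hker X hX.1
    have := hPk ⟨X, hk⟩
    rw [hX.2] at this
    exact (congrArg Subtype.val this).symm
  obtain ⟨s, hs, hinj⟩ := eventually_injOn_of_injective hHd hHi
  have hop := hGd.map_nhds_eq_of_surj (LinearMap.range_eq_top.2 hGs)
  have hgood : s ∩ {y | f y = 0 → h y = 0} ∈ 𝓝 a := Filter.inter_mem hs himp
  have himg : (fun x => (f x, P x)) '' (s ∩ {y | f y = 0 → h y = 0}) ∈ 𝓝 (f a, P a) := by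
    rw [← hop]
    exact Filter.image_mem_map hgood
  have hcont : Filter.Tendsto (fun y => ((0 : F), P y)) (𝓝 a) (𝓝 (f a, P a)) := by
    rw [h0]
    exact (continuous_const.prodMk P.continuous).tendsto a
  -- Openness of `(f, P)` provides `y'` near `a` with `f y' = 0` and `P y' = P y`. Then `h y' = 0 =
  -- h y`, and injectivity of `(h, P)` forces `y' = y`.
  filter_upwards [hcont himg, hs] with y hy hys hy0
  obtain ⟨y', ⟨hy's, hy'0⟩, hyy⟩ := hy
  rw [Prod.mk.injEq] at hyy
  have : y' = y := hinj hy's hys (by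
    change (h y', P y') = (h y, P y)
    rw [hy'0 hyy.1, hy0, hyy.2])
  rw [← this, hyy.1]

end Normed

variable {M : Type*} [TopologicalSpace M] [ChartedSpace E4 M] [IsManifold (𝓡 4) ∞ M]

section Chart

variable {F : Type*} [NormedAddCommGroup F] [NormedSpace ℝ F]

/-- The differential of a vector-valued function, as a map into its values. -/
def diff (f : M → F) (x : M) : E4 →L[ℝ] F := mfderiv (𝓡 4) 𝓘(ℝ, F) f x

theorem hasStrictFDerivAt_chart {f : M → F} {x : M} (hf : ContMDiffAt (𝓡 4) 𝓘(ℝ, F) ∞ f x) :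
    HasStrictFDerivAt (f ∘ (extChartAt (𝓡 4) x).symm) (diff f x) (extChartAt (𝓡 4) x x) := by
  have h1 : ContDiffAt ℝ ∞ (f ∘ (extChartAt (𝓡 4) x).symm) (extChartAt (𝓡 4) x x) := by
    have h := (contMDiffAt_iff.1 hf).2
    rw [ModelWithCorners.range_eq_univ, contDiffWithinAt_univ] at h
    exact h
  have h2 := h1.hasStrictFDerivAt (by simp)
  have e : diff f x = fderiv ℝ (f ∘ (extChartAt (𝓡 4) x).symm) (extChartAt (𝓡 4) x x) := by
    have h3 : mfderiv (𝓡 4) 𝓘(ℝ, F) f x = fderivWithin ℝ (f ∘ (extChartAt (𝓡 4) x).symm)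
        (Set.range (𝓡 4)) (extChartAt (𝓡 4) x x) :=
      MDifferentiableAt.mfderiv (hf.mdifferentiableAt (by simp))
    rw [ModelWithCorners.range_eq_univ, fderivWithin_univ] at h3
    exact h3
  rw [e]
  exact h2

theorem tendsto_chart_symm (x : M) : Filter.Tendsto (extChartAt (𝓡 4) x).symm
    (𝓝 (extChartAt (𝓡 4) x x)) (𝓝 x) := by
  have := (continuousAt_extChartAt_symm (I := 𝓡 4) x).tendsto
  rwa [extChartAt_to_inv] at this

theorem eventually_of_chart {x : M} {p : M → Prop}
    (h : ∀ᶠ z in 𝓝 (extChartAt (𝓡 4) x x), p ((extChartAt (𝓡 4) x).symm z)) :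
    ∀ᶠ y in 𝓝 x, p y := by
  filter_upwards [(continuousAt_extChartAt (I := 𝓡 4) x).tendsto.eventually h,
    extChartAt_source_mem_nhds (I := 𝓡 4) x] with y hy hys
  rwa [(extChartAt (𝓡 4) x).left_inv hys] at hy

theorem comp_chart_self (f : M → F) (x : M) :
    (f ∘ (extChartAt (𝓡 4) x).symm) (extChartAt (𝓡 4) x x) = f x := by
  rw [Function.comp_apply, extChartAt_to_inv]

end Chart

section Surface

variable {F F' : Type*} [NormedAddCommGroup F] [NormedSpace ℝ F] [FiniteDimensional ℝ F]
  [NormedAddCommGroup F'] [NormedSpace ℝ F'] [FiniteDimensional ℝ F']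

theorem diff_eq_zero_of_vanish {f : M → F} {ψ : M → ℝ} {x : M}
    (hf : ContMDiffAt (𝓡 4) 𝓘(ℝ, F) ∞ f x) (hψ : ContMDiffAt (𝓡 4) 𝓘(ℝ, ℝ) ∞ ψ x)
    (hsurj : Function.Surjective (diff f x)) (h0 : f x = 0) (h : ∀ᶠ y in 𝓝 x, f y = 0 → ψ y = 0)
    {X : E4} (hX : diff f x X = 0) : diff ψ x X = 0 :=
  fderiv_eq_zero_of_vanish (hasStrictFDerivAt_chart hf) (hasStrictFDerivAt_chart hψ) hsurj
    ((comp_chart_self f x).trans h0) ((tendsto_chart_symm x).eventually h) hX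

theorem eventually_zero_of_diff_ker_le {f : M → F} {h : M → F'} {x : M}
    (hf : ContMDiffAt (𝓡 4) 𝓘(ℝ, F) ∞ f x) (hh : ContMDiffAt (𝓡 4) 𝓘(ℝ, F') ∞ h x)
    (hsurj : Function.Surjective (diff f x)) (h0 : f x = 0)
    (hker : ∀ X, diff h x X = 0 → diff f x X = 0)
    (himp : ∀ᶠ y in 𝓝 x, f y = 0 → h y = 0) : ∀ᶠ y in 𝓝 x, h y = 0 → f y = 0 :=
  eventually_of_chart (eventually_zero_of_ker_le (hasStrictFDerivAt_chart hf)
    (hasStrictFDerivAt_chart hh) hsurj ((comp_chart_self f x).trans h0) hker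
    ((tendsto_chart_symm x).eventually himp))

theorem nhds_le_map_of_diff_surjective {f : M → F} {x : M}
    (hf : ContMDiffAt (𝓡 4) 𝓘(ℝ, F) ∞ f x) (hsurj : Function.Surjective (diff f x)) :
    𝓝 (f x) ≤ Filter.map f (𝓝 x) := by
  have : CompleteSpace F := FiniteDimensional.complete ℝ F
  have h := (hasStrictFDerivAt_chart hf).map_nhds_eq_of_surj (LinearMap.range_eq_top.2 hsurj)
  rw [comp_chart_self, ← Filter.map_map] at h
  rw [← h]
  exact Filter.map_mono (tendsto_chart_symm x)

theorem diff_comp {f : M → F} {x : M} (hf : ContMDiffAt (𝓡 4) 𝓘(ℝ, F) ∞ f x) (L : F →L[ℝ] F')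
    (X : E4) : diff (fun y => L (f y)) x X = L (diff f x X) := by
  have hL : ContMDiffAt (𝓡 4) 𝓘(ℝ, F') ∞ (fun y => L (f y)) x :=
    L.contMDiff.contMDiffAt.comp x hf
  have h1 := hasStrictFDerivAt_chart hL
  have h2 := L.hasStrictFDerivAt.comp _ (hasStrictFDerivAt_chart hf)
  have := h1.hasFDerivAt.unique h2.hasFDerivAt
  rw [this]
  rfl

theorem diff_prodMk {f : M → F} {h : M → F'} {x : M} (hf : ContMDiffAt (𝓡 4) 𝓘(ℝ, F) ∞ f x)
    (hh : ContMDiffAt (𝓡 4) 𝓘(ℝ, F') ∞ h x) (X : E4) :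
    diff (fun y => (f y, h y)) x X = (diff f x X, diff h x X) := by
  have h1 := hasStrictFDerivAt_chart (hf.prodMk_space hh)
  have h2 := (hasStrictFDerivAt_chart hf).prodMk (hasStrictFDerivAt_chart hh)
  have := h1.hasFDerivAt.unique h2.hasFDerivAt
  rw [this]
  rfl

theorem diff_sub_const {f : M → ℝ} {x : M} (hf : ContMDiffAt (𝓡 4) 𝓘(ℝ, ℝ) ∞ f x) (c : ℝ) :
    diff (fun y => f y - c) x = diff f x := by
  have h1 := hasStrictFDerivAt_chart (hf.sub (contMDiffAt_const (c := c)))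
  have h2 := (hasStrictFDerivAt_chart hf).sub_const c
  exact h1.hasFDerivAt.unique h2.hasFDerivAt

end Surface

end NullGeom

/-! ### Spatial surfaces are transverse to the generators. -/

namespace NullGeom

variable {M : Type*} [TopologicalSpace M] [ChartedSpace E4 M] [IsManifold (𝓡 4) ∞ M]

theorem isTangentTo_of_diff_eq_zero {F : Type*} [NormedAddCommGroup F] [NormedSpace ℝ F]
    [FiniteDimensional ℝ F] {S : Set M} {x : M} {f : M → F}
    (hf : ContMDiffAt (𝓡 4) 𝓘(ℝ, F) ∞ f x) (hsurj : Function.Surjective (diff f x)) (h0 : f x = 0)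
    (hS : ∀ᶠ y in 𝓝 x, f y = 0 → y ∈ S) {X : TangentSpace (𝓡 4) x} (hX : diff f x X = 0) :
    IsTangentTo S x X := by
  intro ψ hψ hψS
  refine diff_eq_zero_of_vanish hf hψ hsurj h0 ?_ hX
  filter_upwards [hS, hψS] with y h1 h2 h3 using h2 (h1 h3)

theorem IsNullFoliation.diff_v_D {g : LorentzMetric M} {v : M → ℝ}
    {D : Π x : M, TangentSpace (𝓡 4) x} (hD : IsNullFoliation g v D) (x : M) :
    diff v x (D x) = 0 :=
  (hD.normal x (D x)).2 (hD.isNull x)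

theorem IsNullFoliation.exists_diff_v_ne_zero {g : LorentzMetric M} {v : M → ℝ}
    {D : Π x : M, TangentSpace (𝓡 4) x} (hD : IsNullFoliation g v D) (x : M) :
    ∃ Z : E4, diff v x Z ≠ 0 := by
  by_contra! h
  refine hD.ne_zero x (g.nondegenerate fun Y => ?_)
  exact (hD.normal x Y).1 (h Y)

/-- In the plane, `e` spans the orthogonal complement of `l`, so `x` is parallel to `e` as well as
orthogonal to it. -/
theorem eq_zero_of_plane {l₁ l₂ e₁ e₂ x₁ x₂ : ℝ} (hl : l₁ ≠ 0 ∨ l₂ ≠ 0) (he : e₁ ≠ 0 ∨ e₂ ≠ 0)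
    (h1 : l₁ * e₁ + l₂ * e₂ = 0) (h2 : l₁ * x₁ + l₂ * x₂ = 0) (h3 : e₁ * x₁ + e₂ * x₂ = 0) :
    x₁ = 0 ∧ x₂ = 0 := by
  have hd : e₁ * x₂ - e₂ * x₁ = 0 := by
    rcases hl with h | h <;> apply mul_left_cancel₀ h
    · linear_combination x₂ * h1 - e₂ * h2
    · linear_combination e₁ * h2 - x₁ * h1
  have hs : 0 < e₁ ^ 2 + e₂ ^ 2 := by
    rcases he with h | h <;> positivity
  constructor <;> apply mul_left_cancel₀ hs.ne'
  · linear_combination e₁ * h3 - e₂ * hd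
  · linear_combination e₂ * h3 + e₁ * hd

/-- Near each of its points, a spatial surface in a leaf is cut out of the leaf by one function, whose
derivative along the null generators is nonzero. -/
theorem IsSpatialSurface.exists_transverse_function {g : LorentzMetric M} {v : M → ℝ}
    {D : Π x : M, TangentSpace (𝓡 4) x} (hD : IsNullFoliation g v D) {S : Set M}
    (hS : IsSpatialSurface g S) {c : ℝ} (hv : ∀ x ∈ S, v x = c) {p : M} (hp : p ∈ S) :
    ∃ (U : Set M) (h : M → ℝ), IsOpen U ∧ p ∈ U ∧ ContMDiffAt (𝓡 4) 𝓘(ℝ, ℝ) ∞ h p ∧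
      ContinuousOn h U ∧ h p = 0 ∧ (∀ y ∈ U, v y = c → h y = 0 → y ∈ S) ∧
      diff h p (D p) ≠ 0 := by
  obtain ⟨Dp, hDp⟩ : ∃ Dp : E4, Dp = D p := ⟨_, rfl⟩
  obtain ⟨U, f, hU, hpU, hf, hfS, hsurj⟩ := hS.surface p hp
  change Function.Surjective (diff f p) at hsurj
  have hfp : ContMDiffAt (𝓡 4) 𝓘(ℝ, ℝ × ℝ) ∞ f p := hf.contMDiffAt (hU.mem_nhds hpU)
  have hf0 : f p = 0 := (hfS p hpU).1 hp
  have hfS' : ∀ᶠ y in 𝓝 p, f y = 0 → y ∈ S :=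
    Filter.mem_of_superset (hU.mem_nhds hpU) fun y hy h => (hfS y hy).2 h
  set w : M → ℝ := fun y => v y - c with hw
  have hvs : ContMDiffAt (𝓡 4) 𝓘(ℝ, ℝ) ∞ v p := hD.smooth_v.contMDiffAt
  have hws : ContMDiffAt (𝓡 4) 𝓘(ℝ, ℝ) ∞ w p := hvs.sub contMDiffAt_const
  have hdw : diff w p = diff v p := diff_sub_const hvs c
  have hwf : ∀ᶠ y in 𝓝 p, f y = 0 → w y = 0 := hfS'.mono fun y hy h =>
    sub_eq_zero.2 (hv y (hy h))
  have hker : ∀ X, diff f p X = 0 → diff v p X = 0 := fun X hX => by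
    rw [← hdw]
    exact diff_eq_zero_of_vanish hfp hws hsurj hf0 hwf hX
  -- `D` is null and non-zero, so it cannot be tangent to a spatial surface.
  have hDf : diff f p Dp ≠ 0 := fun h => by
    have h1 := hS.spatial p hp (D p) (isTangentTo_of_diff_eq_zero hfp hsurj hf0 hfS' (hDp ▸ h))
      (hD.ne_zero p)
    rw [hD.isNull p] at h1
    exact lt_irrefl _ h1
  set e := diff f p Dp with he
  have he' : e.1 ≠ 0 ∨ e.2 ≠ 0 := by
    by_contra! h
    exact hDf (Prod.ext h.1 h.2)
  -- Pairing `f` with the vector `e = df(D)` gives a function whose derivative along `D` is `|e|² >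
  -- 0`.
  set ℓ : ℝ × ℝ →L[ℝ] ℝ := e.1 • ContinuousLinearMap.fst ℝ ℝ ℝ
    + e.2 • ContinuousLinearMap.snd ℝ ℝ ℝ with hℓ
  have hℓa : ∀ z, ℓ z = e.1 * z.1 + e.2 * z.2 := fun z => by simp [hℓ]
  set h : M → ℝ := fun y => ℓ (f y) with hh
  have hhs : ContMDiffAt (𝓡 4) 𝓘(ℝ, ℝ) ∞ h p := ℓ.contMDiff.contMDiffAt.comp p hfp
  have hdh : ∀ X, diff h p X = ℓ (diff f p X) := diff_comp hfp ℓ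
  have hne : diff h p Dp ≠ 0 := by
    rw [hdh, hℓa, ← he]
    have : 0 < e.1 ^ 2 + e.2 ^ 2 := by rcases he' with h | h <;> positivity
    nlinarith
  obtain ⟨A₁, hA₁⟩ := hsurj (1, 0)
  obtain ⟨A₂, hA₂⟩ := hsurj (0, 1)
  have hfac : ∀ X, diff v p X = diff v p A₁ * (diff f p X).1 + diff v p A₂ * (diff f p X).2 := by
    intro X
    have h1 : diff f p (X - (diff f p X).1 • A₁ - (diff f p X).2 • A₂) = 0 := by
      rw [map_sub, map_sub, map_smul, map_smul, hA₁, hA₂]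
      ext <;> simp
    have h2 := hker _ h1
    rw [map_sub, map_sub, map_smul, map_smul] at h2
    simp only [smul_eq_mul] at h2
    linarith
  obtain ⟨Z, hZ⟩ := hD.exists_diff_v_ne_zero p
  have hl : diff v p A₁ ≠ 0 ∨ diff v p A₂ ≠ 0 := by
    by_contra! h
    apply hZ
    rw [hfac, h.1, h.2]
    ring
  -- `dv` factors through `df` as a functional `l`, and `dv(D) = 0` says `l ⊥ e`. So `(v - c, h)`
  -- has no more kernel than `f`, and the two systems cut out the same germ.
  have hgerm := eventually_zero_of_diff_ker_le hfp (hws.prodMk_space hhs) hsurj hf0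
    (fun X hX => by
      rw [diff_prodMk hws hhs, Prod.mk_eq_zero, hdw, hdh, hℓa, hfac X] at hX
      have h0 : diff v p Dp = _ := hfac Dp
      rw [← he, (hDp ▸ hD.diff_v_D p : diff v p Dp = 0)] at h0
      obtain ⟨h1, h2⟩ := eq_zero_of_plane hl he' h0.symm hX.1 hX.2
      exact Prod.ext h1 h2)
    (hwf.mono fun y hy h => by
      rw [Prod.mk_eq_zero]
      exact ⟨hy h, by rw [hh]; simp [h]⟩)
  obtain ⟨V, hV, hVo, hpV⟩ := eventually_nhds_iff.1 (hgerm.and hfS')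
  refine ⟨U ∩ V, h, hU.inter hVo, ⟨hpU, hpV⟩, hhs, ?_, by simp [hh, hf0], ?_,
    hDp ▸ hne⟩
  · exact ℓ.continuous.comp_continuousOn (hf.continuousOn.mono Set.inter_subset_left)
  · intro y hy hvy hhy
    refine (hV y hy.2).2 ((hV y hy.2).1 ?_)
    rw [Prod.mk_eq_zero]
    exact ⟨sub_eq_zero.2 hvy, hhy⟩

end NullGeom

/-! ### The set of zeros of the rate along the generators. -/

namespace NullGeom

variable {M : Type*} [TopologicalSpace M] [ChartedSpace E4 M] [IsManifold (𝓡 4) ∞ M]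

open Set

theorem image_le_of_deriv_le {φ φ' : ℝ → ℝ} {T ε : ℝ}
    (hd : ∀ u ∈ Icc 0 T, HasDerivWithinAt φ (φ' u) (Icc 0 T) u) (hle : ∀ u ∈ Icc 0 T, φ' u ≤ -ε)
    {a b : ℝ} (ha : a ∈ Icc 0 T) (hb : b ∈ Icc 0 T) (hab : a ≤ b) :
    φ b ≤ φ a - ε * (b - a) := by
  have hanti : AntitoneOn (fun u => φ u + ε * u) (Icc 0 T) := by
    have hd' : ∀ u ∈ Icc 0 T, HasDerivWithinAt (fun u => φ u + ε * u) (φ' u + ε) (Icc 0 T) u :=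
      fun u hu => by
        have h2 : HasDerivWithinAt (fun u : ℝ => ε * u) (ε * 1) (Icc 0 T) u :=
          ((hasDerivAt_id u).const_mul ε).hasDerivWithinAt
        rw [mul_one] at h2
        exact (hd u hu).add h2
    refine antitoneOn_of_hasDerivWithinAt_nonpos (f' := fun u => φ' u + ε) (convex_Icc 0 T)
      (fun u hu => (hd' u hu).continuousWithinAt)
      (fun u hu => (hd' u (interior_subset hu)).mono interior_subset)
      fun u hu => ?_
    linarith [hle u (interior_subset hu)]
  have := hanti ha hb hab
  simp only at this
  linarith

/-- A descent at rate at least `ε` over length `T` uses up the initial value `ε T`; strict decrease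
gives uniqueness. -/
theorem existsUnique_zero_of_deriv_le {φ φ' : ℝ → ℝ} {T ε : ℝ} (hε : 0 < ε) (hT : 0 < T)
    (hd : ∀ u ∈ Icc 0 T, HasDerivWithinAt φ (φ' u) (Icc 0 T) u) (hle : ∀ u ∈ Icc 0 T, φ' u ≤ -ε)
    (h0 : φ 0 = ε * T) : ∃ u ∈ Ioc 0 T, φ u = 0 ∧ ∀ u' ∈ Icc 0 T, φ u' = 0 → u' = u := by
  have hTe := image_le_of_deriv_le hd hle ⟨le_rfl, hT.le⟩ ⟨hT.le, le_rfl⟩ hT.le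
  rw [h0] at hTe
  obtain ⟨u, hu, hu0⟩ := intermediate_value_Icc' hT.le (fun u hu => (hd u hu).continuousWithinAt)
    (show (0 : ℝ) ∈ Icc (φ T) (φ 0) from ⟨by linarith, by rw [h0]; positivity⟩)
  refine ⟨u, ⟨hu.1.lt_of_ne ?_, hu.2⟩, hu0, fun u' hu' hu'0 => ?_⟩
  · rintro rfl
    rw [h0] at hu0
    exact (mul_pos hε hT).ne' hu0
  · rcases le_total u u' with h | h
    · have := image_le_of_deriv_le hd hle hu hu' h
      nlinarith
    · have := image_le_of_deriv_le hd hle hu' hu h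
      nlinarith

/-- Without both signs, `a` would be a local extremum. A sign change survives small perturbations,
so transversality can be exploited with a flow known only to be continuous in its initial point. -/
theorem exists_neg_pos_of_hasDerivAt {F : ℝ → ℝ} {d a : ℝ} (hF : HasDerivAt F d a) (hd : d ≠ 0)
    (h0 : F a = 0) {s : Set ℝ} (hs : s ∈ 𝓝 a) : ∃ b ∈ s, ∃ b' ∈ s, F b < 0 ∧ 0 < F b' := by
  have h1 : ∃ b ∈ s, F b < 0 := by
    by_contra! h
    exact hd (IsLocalMin.hasDerivAt_eq_zero
      (Filter.mem_of_superset hs fun y hy => by simpa [h0] using h y hy) hF)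
  have h2 : ∃ b ∈ s, 0 < F b := by
    by_contra! h
    exact hd (IsLocalMax.hasDerivAt_eq_zero
      (Filter.mem_of_superset hs fun y hy => by simpa [h0] using h y hy) hF)
  obtain ⟨b, hb, hFb⟩ := h1
  obtain ⟨b', hb', hFb'⟩ := h2
  exact ⟨b, hb, b', hb', hFb, hFb'⟩

theorem eq_of_along_eq_zero {D : Π x : M, TangentSpace (𝓡 4) x} {v : M → ℝ}
    (hv : MDifferentiable (𝓡 4) 𝓘(ℝ, ℝ) v) (hvD : ∀ x, along D v x = 0) {γ : ℝ → M} {J : Set ℝ}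
    (hJ : Convex ℝ J) (hγ : IsMIntegralCurveOn (I := 𝓡 4) γ D J) {a b : ℝ} (ha : a ∈ J)
    (hb : b ∈ J) : v (γ b) = v (γ a) := by
  have := hJ.norm_image_sub_le_of_norm_hasDerivWithin_le (f := v ∘ γ) (C := 0)
    (fun u hu => hasDerivWithinAt_comp_curve hγ hu (hv _)) (fun u hu => by simp [hvD]) ha hb
  rw [zero_mul, norm_le_zero_iff, sub_eq_zero] at this
  exact this

/-- The first zeros of `r` on the curves `γ p`, `p ∈ S`, before the parameter `r p / ε`. -/
def focalSet (r : M → ℝ) (S : Set M) (γ : M → ℝ → M) (ε : ℝ) : Set M :=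
  {x | r x = 0 ∧ ∃ p ∈ S, ∃ u ∈ Icc 0 (r p / ε), γ p u = x}

variable [T2Space M] {D : Π x : M, TangentSpace (𝓡 4) x} {r : M → ℝ} {S : Set M} {γ : M → ℝ → M}
  {ε : ℝ}

/-- The curves are given one by one; uniqueness identifies them locally with one continuous flow. -/
theorem continuousOn_curves (hD : IsSmoothField D) (hr : Continuous r) (hε : 0 < ε)
    (h0 : ∀ p ∈ S, γ p 0 = p) (hpos : ∀ p ∈ S, 0 < r p)
    (hγ : ∀ p ∈ S, IsMIntegralCurveOn (I := 𝓡 4) (γ p) D (Icc 0 (r p / ε))) :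
    ContinuousOn (Function.uncurry γ) {z : M × ℝ | z.1 ∈ S ∧ z.2 ∈ Icc 0 (r z.1 / ε)} := by
  rintro ⟨p, u⟩ ⟨hp, hu⟩
  obtain ⟨W, η, Φ, hW, hpW, hη, hΦ⟩ := exists_flow_of_curve hD (div_pos (hpos p hp) hε).le (hγ p hp)
  rw [h0 p hp] at hpW
  have heq : ∀ z ∈ {z : M × ℝ | z.1 ∈ S ∧ z.2 ∈ Icc 0 (r z.1 / ε)}, z.1 ∈ W →
      r z.1 / ε < r p / ε + η → Function.uncurry γ z = Function.uncurry Φ z := by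
    rintro ⟨q, s⟩ ⟨hq, hs⟩ hqW hqr
    exact eqOn_of_curves hD (div_pos (hpos q hq) hε).le (hγ q hq) (neg_lt_zero.2 hη) hqr
      (hΦ.curve q hqW) (by rw [h0 q hq, hΦ.zero q hqW]) hs
  have hc : ContinuousAt (Function.uncurry Φ) (p, u) := hΦ.cont.continuousAt
    (prod_mem_nhds (hW.mem_nhds hpW) (Ioo_mem_nhds (by linarith [hu.1]) (by linarith [hu.2])))
  refine hc.continuousWithinAt.congr_of_eventuallyEq ?_
    (heq (p, u) ⟨hp, hu⟩ hpW (by simp only; linarith))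
  have h1 : ∀ᶠ z : M × ℝ in 𝓝 (p, u), z.1 ∈ W := continuous_fst.tendsto _ (hW.mem_nhds hpW)
  have h2 : ∀ᶠ z : M × ℝ in 𝓝 (p, u), r z.1 / ε < r p / ε + η :=
    ((hr.comp continuous_fst).div_const ε).tendsto (p, u) (Iio_mem_nhds (by simp [hη]))
  filter_upwards [self_mem_nhdsWithin, mem_nhdsWithin_of_mem_nhds h1,
    mem_nhdsWithin_of_mem_nhds h2] with z hz hz1 hz2 using heq z hz hz1 hz2

/-- It is the continuous image of a closed set of pairs `(p, u)`, bounded because `r` is bounded on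
`S`. -/
theorem isCompact_focalSet (hD : IsSmoothField D) (hr : Continuous r) (hε : 0 < ε)
    (h0 : ∀ p ∈ S, γ p 0 = p) (hpos : ∀ p ∈ S, 0 < r p)
    (hγ : ∀ p ∈ S, IsMIntegralCurveOn (I := 𝓡 4) (γ p) D (Icc 0 (r p / ε))) (hS : IsCompact S) :
    IsCompact (focalSet r S γ ε) := by
  set E := {z : M × ℝ | z.1 ∈ S ∧ z.2 ∈ Icc 0 (r z.1 / ε)} with hE
  have hcl : IsClosed E := by
    have e : E = {z : M × ℝ | z.1 ∈ S} ∩ ({z | 0 ≤ z.2} ∩ {z | z.2 ≤ r z.1 / ε}) := rfl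
    rw [e]
    exact (hS.isClosed.preimage continuous_fst).inter ((isClosed_le continuous_const
      continuous_snd).inter (isClosed_le continuous_snd
        ((hr.comp continuous_fst).div_const ε)))
  obtain ⟨C, hC⟩ := (hS.image hr).bddAbove
  have hEc : IsCompact E := by
    refine (hS.prod (isCompact_Icc (a := (0 : ℝ)) (b := C / ε))).of_isClosed_subset hcl ?_
    rintro ⟨p, u⟩ ⟨hp, hu⟩
    exact ⟨hp, hu.1, hu.2.trans (div_le_div_of_nonneg_right (hC ⟨p, hp, rfl⟩) hε.le)⟩
  have hc := continuousOn_curves hD hr hε h0 hpos hγ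
  have hcl2 : IsClosed (E ∩ (fun z => r (Function.uncurry γ z)) ⁻¹' {0}) :=
    (hr.comp_continuousOn hc).preimage_isClosed_of_isClosed hcl isClosed_singleton
  have hF : IsCompact (E ∩ (fun z => r (Function.uncurry γ z)) ⁻¹' {0}) :=
    hEc.of_isClosed_subset hcl2 inter_subset_left
  have e : focalSet r S γ ε = Function.uncurry γ ''
      (E ∩ (fun z => r (Function.uncurry γ z)) ⁻¹' {0}) := by
    ext x
    constructor
    · rintro ⟨hx, p, hp, u, hu, rfl⟩
      exact ⟨(p, u), ⟨⟨hp, hu⟩, hx⟩, rfl⟩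
    · rintro ⟨⟨p, u⟩, ⟨⟨hp, hu⟩, hx⟩, rfl⟩
      exact ⟨hx, p, hp, u, hu, rfl⟩
  rw [e]
  exact hF.image_of_continuousOn (hc.mono inter_subset_left)

/-- The set of first zeros is open in the zero set of `r` on the leaf of `v` through `S`. -/
theorem eventually_mem_focalSet (hD : IsSmoothField D) (hr : ContMDiff (𝓡 4) 𝓘(ℝ, ℝ) ∞ r)
    (hε : 0 < ε) (h0 : ∀ p ∈ S, γ p 0 = p) (hpos : ∀ p ∈ S, 0 < r p)
    (hγ : ∀ p ∈ S, IsMIntegralCurveOn (I := 𝓡 4) (γ p) D (Icc 0 (r p / ε)))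
    (hdec : ∀ p ∈ S, ∀ u ∈ Icc 0 (r p / ε), along D r (γ p u) ≤ -ε)
    {v : M → ℝ} (hv : MDifferentiable (𝓡 4) 𝓘(ℝ, ℝ) v) (hvD : ∀ x, along D v x = 0) {c : ℝ}
    (htrans : ∀ p ∈ S, ∃ (U : Set M) (h : M → ℝ), IsOpen U ∧ p ∈ U ∧
      MDifferentiableAt (𝓡 4) 𝓘(ℝ, ℝ) h p ∧ ContinuousOn h U ∧ h p = 0 ∧
      (∀ y ∈ U, v y = c → h y = 0 → y ∈ S) ∧ along D h p ≠ 0) {x : M}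
    (hx : x ∈ focalSet r S γ ε) : ∀ᶠ q in 𝓝 x, v q = c → r q = 0 → q ∈ focalSet r S γ ε := by
  obtain ⟨hx0, p, hp, τ, hτ, rfl⟩ := hx
  have hrc : Continuous r := hr.continuous
  have hrd : MDifferentiable (𝓡 4) 𝓘(ℝ, ℝ) r := hr.mdifferentiable (by simp)
  have hτ0 : 0 < τ := hτ.1.lt_of_ne (by
    rintro rfl
    rw [h0 p hp] at hx0
    exact (hpos p hp).ne' hx0)
  have hend : ∀ q ∈ S, r (γ q (r q / ε)) ≤ 0 := fun q hq => by
    have hT := div_pos (hpos q hq) hε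
    have := image_le_of_deriv_le (φ := r ∘ γ q)
      (fun u hu => hasDerivWithinAt_comp_curve (hγ q hq) hu (hrd _)) (hdec q hq)
      ⟨le_rfl, hT.le⟩ ⟨hT.le, le_rfl⟩ hT.le
    simp only [Function.comp_apply, h0 q hq, sub_zero] at this
    rwa [mul_div_cancel₀ _ hε.ne', sub_self] at this
  -- Flow backwards from neighbours `q` of `x`, for times down to slightly below `-τ`, where `x`
  -- itself reaches `p`.
  obtain ⟨W, η, Φ, hW, hxW, hη, hΦ, hΦp⟩ := exists_flow_back_of_curve hD hτ.1
    ((hγ p hp).mono (Icc_subset_Icc_right hτ.2))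
  rw [h0 p hp] at hΦp
  set x := γ p τ with hxdef
  have hΦat : ∀ s ∈ Ioo (-(τ + η)) η, ContinuousAt (Function.uncurry Φ) (x, s) := fun s hs =>
    hΦ.cont.continuousAt (prod_mem_nhds (hW.mem_nhds hxW) (Ioo_mem_nhds hs.1 hs.2))
  obtain ⟨U, h, hU, hpU, hhd, hhc, hhp, hUS, hdh⟩ := htrans p hp
  have hAo : {y | along D r y < 0} ∈ 𝓝 x := by
    have hc : ContinuousAt (along D r) x :=
      (contMDiffAt_along hr hD.contMDiffAt).continuousAt
    exact hc.tendsto (Iio_mem_nhds (by linarith [hdec p hp τ hτ]))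
  have h00 : Φ x 0 = x := hΦ.zero x hxW
  obtain ⟨V₁, hV₁, B, hB, hVB⟩ := mem_nhds_prod_iff.1
    ((hΦat 0 ⟨by linarith, hη⟩).preimage_mem_nhds (by
      change {y | along D r y < 0} ∈ 𝓝 (Φ x 0)
      rwa [h00]))
  -- For times within `κ` of 0 and `q` near `x`, the flow stays where `Dr < 0`.
  obtain ⟨κ, hκ, hκB⟩ := Metric.mem_nhds_iff.1 hB
  have hU' : U ∩ {y | r p / ε - κ / 2 < r y / ε} ∈ 𝓝 (Φ x (-τ)) := by
    rw [hΦp]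
    exact Filter.inter_mem (hU.mem_nhds hpU)
      ((hrc.div_const ε).tendsto p (Ioi_mem_nhds (by linarith)))
  obtain ⟨V₂, hV₂, B₂, hB₂, hVB₂⟩ := mem_nhds_prod_iff.1
    ((hΦat (-τ) ⟨by linarith, by linarith⟩).preimage_mem_nhds hU')
  obtain ⟨δ₀, hδ₀, hδB₂⟩ := Metric.mem_nhds_iff.1 hB₂
  -- The bound `δ₀` keeps the flow near `p`, `η` keeps it defined, `τ` keeps the hitting time
  -- negative, and `κ/2` limits an overshoot of the end parameter.
  set δ := min δ₀ (min (κ / 2) (min η τ)) with hδ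
  have hδ0 : 0 < δ := lt_min hδ₀ (lt_min (by positivity) (lt_min hη hτ0))
  have hδ1 : δ ≤ δ₀ := min_le_left _ _
  have hδ2 : δ ≤ κ / 2 := (min_le_right _ _).trans (min_le_left _ _)
  have hδ3 : δ ≤ η := (min_le_right _ _).trans ((min_le_right _ _).trans (min_le_left _ _))
  have hδ4 : δ ≤ τ := (min_le_right _ _).trans ((min_le_right _ _).trans (min_le_right _ _))
  have hnear : ∀ q ∈ V₂, ∀ s ∈ Ioo (-τ - δ) (-τ + δ), Φ q s ∈ U ∧
      r p / ε - κ / 2 < r (Φ q s) / ε := fun q hq s hs =>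
    hVB₂ (mk_mem_prod hq (hδB₂ (by
      rw [Real.ball_eq_Ioo]
      exact ⟨by linarith [hs.1], by linarith [hs.2]⟩)))
  have hdom : ∀ s ∈ Ioo (-τ - δ) (-τ + δ), s ∈ Ioo (-(τ + η)) η := fun s hs =>
    ⟨by linarith [hs.1], by linarith [hs.2]⟩
  have hxV₂ : x ∈ V₂ := mem_of_mem_nhds hV₂
  have hFd : HasDerivAt (h ∘ Φ x) (along D h (Φ x (-τ))) (-τ) :=
    (hasDerivWithinAt_comp_curve (hΦ.curve x hxW) ⟨by linarith, by linarith⟩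
      (by rw [hΦp]; exact hhd)).hasDerivAt (Ioo_mem_nhds (by linarith) (by linarith))
  obtain ⟨a, ha, b, hb, hFa, hFb⟩ := exists_neg_pos_of_hasDerivAt hFd (by rw [hΦp]; exact hdh)
    (by simp [hΦp, hhp]) (Ioo_mem_nhds (a := -τ - δ) (b := -τ + δ) (by linarith) (by linarith))
  have hcq : ∀ s ∈ Ioo (-τ - δ) (-τ + δ), ContinuousAt (fun q => h (Φ q s)) x := by
    intro s hs
    have h1 : ContinuousAt h (Φ x s) := hhc.continuousAt (hU.mem_nhds (hnear x hxV₂ s hs).1)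
    have h2 : ContinuousAt (fun q => Function.uncurry Φ (q, s)) x :=
      ContinuousAt.comp (f := fun q => (q, s)) (hΦat s (hdom s hs)) (by fun_prop)
    exact ContinuousAt.comp (f := fun q => Φ q s) h1 h2
  filter_upwards [hW.mem_nhds hxW, hV₁, hV₂, (hcq a ha).tendsto (Iio_mem_nhds hFa),
    (hcq b hb).tendsto (Ioi_mem_nhds hFb)] with q hqW hq1 hq2 hqa hqb hqv hqr
  have hsub : uIcc a b ⊆ Ioo (-τ - δ) (-τ + δ) := by
    intro s hs
    rw [mem_uIcc] at hs
    rcases hs with hs | hs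
    · exact ⟨ha.1.trans_le hs.1, hs.2.trans_lt hb.2⟩
    · exact ⟨hb.1.trans_le hs.1, hs.2.trans_lt ha.2⟩
  have hcs : ContinuousOn (fun s => h (Φ q s)) (uIcc a b) :=
    hhc.comp (((hΦ.curve q hqW).continuousOn).mono fun s hs => hdom s (hsub hs))
      fun s hs => (hnear q hq2 s (hsub hs)).1
  -- The signs of `h` at times `a` and `b` persist from `x` to `q`, so the orbit of `q` meets `h =
  -- 0`, that is `S`, in between.
  obtain ⟨s, hs, hs0⟩ := intermediate_value_uIcc hcs
    (show (0 : ℝ) ∈ uIcc (h (Φ q a)) (h (Φ q b)) from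
      mem_uIcc.2 (Or.inl ⟨le_of_lt hqa, le_of_lt hqb⟩))
  have hs' := hsub hs
  have hsd := hdom s hs'
  have h0d : (0 : ℝ) ∈ Ioo (-(τ + η)) η := ⟨by linarith, hη⟩
  have hvp : v (Φ q s) = c := by
    rw [eq_of_along_eq_zero hv hvD (convex_Ioo _ _) (hΦ.curve q hqW) h0d hsd, hΦ.zero q hqW, hqv]
  have hpS : Φ q s ∈ S := hUS _ (hnear q hq2 s hs').1 hvp hs0
  have hT := (hnear q hq2 s hs').2
  set p' := Φ q s with hp'
  have hT0 : 0 < r p' / ε := div_pos (hpos p' hpS) hε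
  have hβ : IsMIntegralCurveOn (I := 𝓡 4) (Φ q ∘ (· + s)) D (Ioo (-(τ + η) - s) (η - s)) :=
    ((hΦ.curve q hqW).comp_add s).mono fun u hu => by
      change u + s ∈ Ioo (-(τ + η)) η
      exact ⟨by linarith [hu.1], by linarith [hu.2]⟩
  have hβ0 : γ p' 0 = (Φ q ∘ (· + s)) 0 := by
    rw [h0 p' hpS]
    simp [hp']
  -- If the curve from `p'` ended before reaching `q`, then `r ≤ 0` at its end. The remaining time
  -- to `q` is less than `κ`, so `r` would strictly decrease there and be negative at `q`,
  -- contradicting `r q = 0`.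
  rcases le_or_gt (-s) (r p' / ε) with hle | hlt
  · refine ⟨hqr, p', hpS, -s, ⟨by linarith [hs'.2], hle⟩, ?_⟩
    have := eqOn_of_curves hD (by linarith [hs'.2] : 0 ≤ -s)
      ((hγ p' hpS).mono (Icc_subset_Icc_right hle)) (by linarith [hsd.1]) (by linarith) hβ hβ0
      (right_mem_Icc.2 (by linarith [hs'.2]))
    rw [this, Function.comp_apply, neg_add_cancel, hΦ.zero q hqW]
  · exfalso
    have heq := eqOn_of_curves hD hT0.le (hγ p' hpS) (by linarith [hsd.1]) (by linarith) hβ hβ0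
      (right_mem_Icc.2 hT0.le)
    have hneg := hend p' hpS
    rw [heq, Function.comp_apply] at hneg
    have hsubI : Icc (r p' / ε + s) 0 ⊆ Ioo (-(τ + η)) η := fun w hw =>
      ⟨by linarith [hw.1, hsd.1], by linarith [hw.2]⟩
    have hanti : StrictAntiOn (r ∘ Φ q) (Icc (r p' / ε + s) 0) := by
      refine strictAntiOn_of_hasDerivWithinAt_neg (f' := fun w => along D r (Φ q w))
        (convex_Icc _ _)
        (hrc.comp_continuousOn ((hΦ.curve q hqW).continuousOn.mono hsubI)) (fun w hw => ?_)
        fun w hw => ?_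
      · exact (hasDerivWithinAt_comp_curve (hΦ.curve q hqW) (hsubI (interior_subset hw))
          (hrd _)).mono (interior_subset.trans hsubI)
      · have hw' := interior_subset hw
        refine hVB (mk_mem_prod hq1 (hκB ?_))
        rw [Real.ball_eq_Ioo]
        exact ⟨by linarith [hw'.1, hs'.1, hτ.2], by linarith [hw'.2]⟩
    have := hanti (left_mem_Icc.2 (by linarith)) (right_mem_Icc.2 (by linarith)) (by linarith)
    simp only [Function.comp_apply, hΦ.zero q hqW, hqr] at this
    linarith

end NullGeom

/-! ### Trapping horizons as joint level sets of the rate and `v`. -/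

namespace NullGeom

variable {M : Type*} [TopologicalSpace M] [ChartedSpace E4 M] [IsManifold (𝓡 4) ∞ M]

open Set

theorem diff_pair_surjective {r v : M → ℝ} {x : M} {X Z : E4}
    (hr : ContMDiffAt (𝓡 4) 𝓘(ℝ, ℝ) ∞ r x) (hv : ContMDiffAt (𝓡 4) 𝓘(ℝ, ℝ) ∞ v x)
    (hrX : diff r x X ≠ 0) (hvX : diff v x X = 0) (hvZ : diff v x Z ≠ 0) :
    Function.Surjective (diff (fun y => (r y, v y)) x) := by
  rintro ⟨a, b⟩
  refine ⟨(b / diff v x Z) • Z + ((a - b / diff v x Z * diff r x Z) / diff r x X) • X, ?_⟩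
  rw [diff_prodMk hr hv]
  simp only [map_add, map_smul, smul_eq_mul, hvX, mul_zero, add_zero, Prod.mk.injEq]
  constructor
  · field_simp
    ring
  · field_simp

section Horizon

variable {g : LorentzMetric M} {nabla : Connection M} {v : M → ℝ}
  {D : Π x : M, TangentSpace (𝓡 4) x}

/-- On `N` the pair `(r, v)` is a submersion, so the levels are surfaces with tangent planes `ker dr
∩ ker dv`. These lie in `D^⊥` without containing `D`, hence are spacelike. -/
theorem isTrappingHorizon_levels (hn : IsLeviCivita g nabla) (hD : IsNullFoliation g v D)
    (t : ∀ x : M, NullTetrad g D x) {N : Set M} (hN : IsOpen N) {a b : ℝ}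
    (hdec : ∀ x ∈ N, along D (fun y => (t y).rate nabla) x < 0)
    (hne : ∀ s ∈ Ioo a b, ∃ x ∈ N, (t x).rate nabla = 0 ∧ v x = s) :
    IsTrappingHorizon g nabla v D a b
      (fun s => N ∩ {x | (t x).rate nabla = 0 ∧ v x = s}) := by
  set r : M → ℝ := fun y => (t y).rate nabla with hr
  have hrs : ContMDiff (𝓡 4) 𝓘(ℝ, ℝ) ∞ r := contMDiff_rate hn hD t
  have hvs := hD.smooth_v
  have hdr : ∀ x ∈ N, ∃ Dx : E4, Dx = D x ∧ diff r x Dx ≠ 0 ∧ diff v x Dx = 0 := fun x hx =>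
    ⟨D x, rfl, (hdec x hx).ne, hD.diff_v_D x⟩
  have hsurj : ∀ x ∈ N, Function.Surjective (diff (fun y => (r y, v y)) x) := by
    intro x hx
    obtain ⟨Dx, -, h1, h2⟩ := hdr x hx
    obtain ⟨Z, hZ⟩ := hD.exists_diff_v_ne_zero x
    exact diff_pair_surjective hrs.contMDiffAt hvs.contMDiffAt h1 h2 hZ
  have hws : ∀ s, ContMDiff (𝓡 4) 𝓘(ℝ, ℝ) ∞ fun y => v y - s := fun s => hvs.sub contMDiff_const
  have hsurj' : ∀ s, ∀ x ∈ N, Function.Surjective (diff (fun y => (r y, v y - s)) x) := by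
    intro s x hx z
    obtain ⟨X, hX⟩ := hsurj x hx z
    refine ⟨X, ?_⟩
    rw [diff_prodMk hrs.contMDiffAt hvs.contMDiffAt] at hX
    rw [diff_prodMk hrs.contMDiffAt (hws s).contMDiffAt, diff_sub_const hvs.contMDiffAt, hX]
  have hmem : ∀ s, ∀ y ∈ N, (r y, v y - s) = 0 → y ∈ N ∩ {x | r x = 0 ∧ v x = s} := by
    intro s y hy h
    rw [Prod.mk_eq_zero] at h
    exact ⟨hy, h.1, sub_eq_zero.1 h.2⟩
  have htan : ∀ s, ∀ x ∈ N ∩ {x | r x = 0 ∧ v x = s}, ∀ X : E4, diff r x X = 0 → diff v x X = 0 →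
      IsTangentTo (N ∩ {x | r x = 0 ∧ v x = s}) x X := by
    rintro s x ⟨hx, hx0, hxs⟩ X h1 h2
    refine isTangentTo_of_diff_eq_zero (f := fun y => (r y, v y - s))
      (hrs.prodMk_space (hws s)).contMDiffAt (hsurj' s x hx) (by simp [hx0, hxs])
      (Filter.mem_of_superset (hN.mem_nhds hx) (hmem s)) ?_
    rw [diff_prodMk hrs.contMDiffAt (hws s).contMDiffAt, diff_sub_const hvs.contMDiffAt, h1, h2]
    rfl
  refine ⟨fun s hs => ?_, fun s hs x hx => hx.2.2, fun s hs => ⟨fun x hx => ?_, fun x hx X hX h0 => ?_⟩,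
    fun s hs x hx => ?_, fun s hs x hx => ?_⟩
  · obtain ⟨x, hx, h1, h2⟩ := hne s hs
    exact ⟨x, hx, h1, h2⟩
  · refine ⟨N, fun y => (r y, v y - s), hN, hx.1, (hrs.prodMk_space (hws s)).contMDiffOn,
      fun y hy => ⟨fun h => ?_, hmem s y hy⟩, hsurj' s x hx.1⟩
    rw [Prod.mk_eq_zero]
    exact ⟨h.2.1, sub_eq_zero.2 h.2.2⟩
  · have h1 : diff r x X = 0 := hX r hrs.contMDiffAt (Filter.Eventually.of_forall fun y hy => hy.2.1)
    have h2 : diff v x X = 0 := by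
      rw [← diff_sub_const hvs.contMDiffAt s]
      exact hX _ (hws s).contMDiffAt (Filter.Eventually.of_forall fun y hy => sub_eq_zero.2 hy.2.2)
    rcases (t x).form_self_neg_or ((hD.normal x X).1 h2) with h | ⟨a, ha⟩
    · exact h
    · exfalso
      obtain ⟨Dx, hDx, h3, -⟩ := hdr x hx.1
      have h4 : diff r x (a • Dx) = 0 := by
        rw [hDx]
        exact ha ▸ h1
      rw [map_smul, smul_eq_mul] at h4
      apply h0
      rw [ha, (mul_eq_zero.1 h4).resolve_right h3, zero_smul]
  · obtain ⟨Dx, hDx, h3, h4⟩ := hdr x hx.1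
    have key : ∀ X Y : E4, diff v x X = 0 → Y = X + (-(diff r x X / diff r x Dx)) • Dx →
        diff r x Y = 0 ∧ diff v x Y = 0 := by
      rintro X Y hX rfl
      rw [map_add, map_smul, map_add, map_smul, hX, h4, smul_eq_mul, smul_eq_mul, mul_zero]
      refine ⟨?_, add_zero _⟩
      field_simp
      ring
    have hvX : diff v x (t x).X = 0 := (hD.normal x _).2 (t x).D_X
    have hvY : diff v x (t x).Y = 0 := (hD.normal x _).2 (t x).D_Y
    -- The rotation parameters solve `dr = 0` for the new `X` and `Y`; `dv = 0` holds throughout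
    -- since `dv(D) = 0`.
    refine ⟨(t x).rotate (-(diff r x (t x).X / diff r x Dx)) (-(diff r x (t x).Y / diff r x Dx)),
      ?_, ?_, ?_⟩
    · obtain ⟨k1, k2⟩ := key _ _ hvX rfl
      rw [hDx] at k1 k2
      rw [hDx]
      exact htan s x hx _ k1 k2
    · obtain ⟨k1, k2⟩ := key _ _ hvY rfl
      rw [hDx] at k1 k2
      rw [hDx]
      exact htan s x hx _ k1 k2
    · rw [NullTetrad.rho_eq hn hD, NullTetrad.rate_eq hn hD _ (t x), show (t x).rate nabla = 0 from hx.2.1]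
      simp
  · refine ⟨N ∩ v ⁻¹' Ioo a b, r, hN.inter (isOpen_Ioo.preimage hvs.continuous),
      ⟨hx.1, by rw [mem_preimage, hx.2.2]; exact hs⟩, hrs.contMDiffOn, fun y hy => ?_, ?_⟩
    · simp only [mem_iUnion]
      constructor
      · rintro ⟨s', -, h⟩
        exact h.2.1
      · intro h
        exact ⟨v y, hy.2, hy.1, h, rfl⟩
    · rintro ⟨z₁, z₂⟩
      obtain ⟨X, hX⟩ := hsurj x hx.1 (z₁, z₂)
      rw [diff_prodMk hrs.contMDiffAt hvs.contMDiffAt] at hX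
      exact ⟨X, hX⟩

end Horizon

/-- A compact subset, relatively open in the zero set of `(r, v - c)`, persists for nearby levels
of `v`. -/
theorem exists_levels [T2Space M] {r v : M → ℝ} (hr : ContMDiff (𝓡 4) 𝓘(ℝ, ℝ) ∞ r)
    (hv : ContMDiff (𝓡 4) 𝓘(ℝ, ℝ) ∞ v) {c : ℝ} {H O : Set M} (hH : IsCompact H) (hne : H.Nonempty)
    (hO : IsOpen O) (hHO : H ⊆ O) (hH0 : ∀ x ∈ H, r x = 0 ∧ v x = c)
    (hopen : ∀ x ∈ H, ∀ᶠ q in 𝓝 x, v q = c → r q = 0 → q ∈ H)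
    (hsurj : ∀ x ∈ H, Function.Surjective (diff (fun y => (r y, v y)) x)) :
    ∃ (N : Set M) (η : ℝ), IsOpen N ∧ N ⊆ O ∧ 0 < η ∧ N ∩ {x | r x = 0 ∧ v x = c} = H ∧
      ∀ s ∈ Ioo (c - η) (c + η), (∃ x ∈ N, r x = 0 ∧ v x = s) ∧
        IsCompact (N ∩ {x | r x = 0 ∧ v x = s}) := by
  have : LocallyCompactSpace M := ChartedSpace.locallyCompactSpace E4 M
  have hG : {q | v q = c → r q = 0 → q ∈ H} ∈ 𝓝ˢ H := mem_nhdsSet_iff_forall.2 hopen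
  obtain ⟨G, hGo, hHG, hG⟩ := mem_nhdsSet_iff_exists.1 hG
  obtain ⟨N, hN, hHN, hNc, hcomp⟩ := exists_open_between_and_isCompact_closure hH (hGo.inter hO)
    (subset_inter hHG hHO)
  have hrc := hr.continuous
  have hvc := hv.continuous
  -- On the boundary of `N`, `r = 0` excludes `v = c`, since `H` lies inside `N`; compactness turns
  -- this into a gap.
  obtain ⟨η₁, hη₁, hbd⟩ : ∃ η > 0, ∀ q ∈ (closure N \ N) ∩ {q | r q = 0}, η ≤ |v q - c| := by
    have hB : IsCompact ((closure N \ N) ∩ {q | r q = 0}) :=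
      (hcomp.diff hN).inter_right (isClosed_eq hrc continuous_const)
    refine hB.exists_forall_le' (a := 0) (by fun_prop) fun q hq => ?_
    rw [abs_pos, sub_ne_zero]
    intro hvq
    exact hq.1.2 (hHN (hG (hNc hq.1.1).1 hvq hq.2))
  obtain ⟨x₀, hx₀⟩ := hne
  -- A submersion is open, so nearby levels are not empty.
  have himg : (fun y => (r y, v y)) '' N ∈ 𝓝 ((0 : ℝ), c) := by
    have h1 := nhds_le_map_of_diff_surjective (hr.prodMk_space hv).contMDiffAt (hsurj x₀ hx₀)
    simp only [(hH0 x₀ hx₀).1, (hH0 x₀ hx₀).2] at h1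
    exact h1 (Filter.image_mem_map (hN.mem_nhds (hHN hx₀)))
  have hline : ∀ᶠ s in 𝓝 c, ((0 : ℝ), s) ∈ (fun y => (r y, v y)) '' N :=
    (Continuous.prodMk_right (0 : ℝ)).tendsto c himg
  obtain ⟨η₂, hη₂, hball⟩ := Metric.eventually_nhds_iff_ball.1 hline
  refine ⟨N, min η₁ η₂, hN, fun x hx => (hNc (subset_closure hx)).2, lt_min hη₁ hη₂, ?_,
    fun s hs => ⟨?_, ?_⟩⟩
  · ext x
    exact ⟨fun h => hG (hNc (subset_closure h.1)).1 h.2.2 h.2.1, fun h => ⟨hHN h, hH0 x h⟩⟩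
  · obtain ⟨y, hy, hys⟩ := hball s (by
      rw [Real.ball_eq_Ioo]
      exact ⟨by linarith [hs.1, min_le_right η₁ η₂], by linarith [hs.2, min_le_right η₁ η₂]⟩)
    rw [Prod.mk.injEq] at hys
    exact ⟨y, hy, hys⟩
  · have e : N ∩ {x | r x = 0 ∧ v x = s} = closure N ∩ ({x | r x = 0} ∩ {x | v x = s}) := by
      ext x
      refine ⟨fun h => ⟨subset_closure h.1, h.2⟩, fun h => ⟨?_, h.2⟩⟩
      by_contra hx
      have h1 := hbd x ⟨⟨h.1, hx⟩, h.2.1⟩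
      rw [show v x = s from h.2.2] at h1
      have h2 : |s - c| < min η₁ η₂ := abs_lt.2 ⟨by linarith [hs.1], by linarith [hs.2]⟩
      linarith [min_le_left η₁ η₂]
    rw [e]
    exact hcomp.inter_right ((isClosed_eq hrc continuous_const).inter
      (isClosed_eq hvc continuous_const))

end NullGeom

end

/-! ### Assembly of the theorem. -/

open NullGeom in
theorem proposition1 {M : Type*} [TopologicalSpace M] [T2Space M] [ChartedSpace E4 M]
    [IsManifold (𝓡 4) ∞ M]
    (g : LorentzMetric M) (nabla : Connection M) (hnabla : IsLeviCivita g nabla)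
    (v : M → ℝ) (D : Π x : M, TangentSpace (𝓡 4) x) (hD : IsNullFoliation g v D)
    (t : ∀ x : M, NullTetrad g D x)
    (c : ℝ) (S₀ : Set M) (hS₀_spatial : IsSpatialSurface g S₀) (hS₀_compact : IsCompact S₀)
    (hS₀_nonempty : S₀.Nonempty) (hS₀_subset : ∀ x ∈ S₀, v x = c)
    (ρ₀ : M → ℝ) (hρ₀ : ∀ p ∈ S₀, (t p).rho nabla = (ρ₀ p : ℂ)) (hρ₀_pos : ∀ p ∈ S₀, 0 < ρ₀ p)
    (ε : ℝ) (hε : 0 < ε)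
    (γ : M → ℝ → M) (hγ_zero : ∀ p ∈ S₀, γ p 0 = p)
    (hγ : ∀ p ∈ S₀, IsMIntegralCurveOn (I := 𝓡 4) (γ p) D (Set.Icc 0 (ρ₀ p / ε)))
    (hgauge : ∀ p ∈ S₀, ∀ u ∈ Set.Icc 0 (ρ₀ p / ε),
      (t (γ p u)).rho nabla + ((t (γ p u)).epsSum nabla : ℂ) = 0)
    (henergy : ∀ p ∈ S₀, ∀ u ∈ Set.Ioo 0 (ρ₀ p / ε),
      Phi00 nabla D (γ p u) ≤ -(‖(t (γ p u)).sigma nabla‖ ^ 2 + ε)) :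
    ∃ (η : ℝ) (H : ℝ → Set M), 0 < η ∧
      IsTrappingHorizon g nabla v D (c - η) (c + η) H ∧
      (∀ s ∈ Set.Ioo (c - η) (c + η), IsCompact (H s)) ∧
      (∀ p ∈ S₀, ∃! u : ℝ, u ∈ Set.Icc 0 (ρ₀ p / ε) ∧ γ p u ∈ H c) ∧
      (∀ x ∈ H c, ∃ p ∈ S₀, ∃ u ∈ Set.Ioc 0 (ρ₀ p / ε), γ p u = x) ∧
      (∀ p ∈ S₀, ∃ u ∈ Set.Ioc 0 (ρ₀ p / ε), (t (γ p u)).rho nabla = 0) := by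
  obtain ⟨r, hr⟩ : ∃ r : M → ℝ, r = fun y => (t y).rate nabla := ⟨_, rfl⟩
  have hrho : ∀ x, (t x).rho nabla = (r x : ℂ) := fun x => by
    rw [hr]
    exact (t x).rho_eq hnabla hD
  have hrs : ContMDiff (𝓡 4) 𝓘(ℝ, ℝ) ∞ r := hr ▸ contMDiff_rate hnabla hD t
  have hrd : MDifferentiable (𝓡 4) 𝓘(ℝ, ℝ) r := hrs.mdifferentiable (by simp)
  have hvd : MDifferentiable (𝓡 4) 𝓘(ℝ, ℝ) v := hD.smooth_v.mdifferentiable (by simp)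
  have hvD : ∀ x, along D v x = 0 := fun x => hD.diff_v_D x
  have hρr : ∀ p ∈ S₀, ρ₀ p = r p := fun p hp => by
    have := hρ₀ p hp
    rw [hrho p] at this
    exact_mod_cast this.symm
  have hpos : ∀ p ∈ S₀, 0 < r p := fun p hp => hρr p hp ▸ hρ₀_pos p hp
  have hT : ∀ p ∈ S₀, 0 < r p / ε := fun p hp => div_pos (hpos p hp) hε
  have hγ' : ∀ p ∈ S₀, IsMIntegralCurveOn (I := 𝓡 4) (γ p) D (Set.Icc 0 (r p / ε)) :=
    fun p hp => hρr p hp ▸ hγ p hp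
  have halc : Continuous (along D r) := continuous_iff_continuousAt.2 fun x =>
    (contMDiffAt_along hrs hD.smooth_D.contMDiffAt).continuousAt
  have hdec : ∀ p ∈ S₀, ∀ u ∈ Set.Icc 0 (r p / ε), along D r (γ p u) ≤ -ε := by
    intro p hp
    -- The energy condition holds on the open interval only; continuity of `Dr` carries the bound to
    -- both ends.
    have hcl : closure (Set.Ioo 0 (r p / ε)) = Set.Icc 0 (r p / ε) := closure_Ioo (hT p hp).ne
    have hc : ContinuousOn (fun u => along D r (γ p u)) (closure (Set.Ioo 0 (r p / ε))) := by
      rw [hcl]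
      exact halc.comp_continuousOn (hγ' p hp).continuousOn
    rw [← hcl]
    refine fun u hu => le_on_closure (fun u hu => ?_) hc continuousOn_const hu
    have h1 := hgauge p hp u (hρr p hp ▸ Set.Ioo_subset_Icc_self hu)
    have h2 := henergy p hp u (hρr p hp ▸ hu)
    have h3 := focusing hnabla hD t (γ p u)
    rw [hrho, ← Complex.ofReal_add, Complex.ofReal_eq_zero] at h1
    -- The gauge gives `ε + ε̄ = -r`, so the terms `(ε + ε̄) r + r²` cancel.
    rw [← hr, ← congrFun hr (γ p u), eq_neg_of_add_eq_zero_right h1] at h3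
    linarith
  have hzero : ∀ p ∈ S₀, ∃ u ∈ Set.Ioc 0 (r p / ε), r (γ p u) = 0 ∧
      ∀ u' ∈ Set.Icc 0 (r p / ε), r (γ p u') = 0 → u' = u := fun p hp =>
    existsUnique_zero_of_deriv_le (φ := r ∘ γ p) hε (hT p hp)
      (fun u hu => hasDerivWithinAt_comp_curve (hγ' p hp) hu (hrd _)) (hdec p hp) (by
        rw [Function.comp_apply, hγ_zero p hp, mul_div_cancel₀ _ hε.ne'])
  set F := focalSet r S₀ γ ε with hF
  have hFc : IsCompact F := isCompact_focalSet hD.smooth_D hrs.continuous hε hγ_zero hpos hγ'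
    hS₀_compact
  have hFne : F.Nonempty := by
    obtain ⟨p, hp⟩ := hS₀_nonempty
    obtain ⟨u, hu, hu0, -⟩ := hzero p hp
    exact ⟨γ p u, hu0, p, hp, u, Set.Ioc_subset_Icc_self hu, rfl⟩
  have hF0 : ∀ x ∈ F, r x = 0 ∧ v x = c := by
    rintro x ⟨hx, p, hp, u, hu, rfl⟩
    refine ⟨hx, ?_⟩
    rw [eq_of_along_eq_zero hvd hvD (convex_Icc _ _) (hγ' p hp)
      (Set.left_mem_Icc.2 (hT p hp).le) hu, hγ_zero p hp, hS₀_subset p hp]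
  have hFD : F ⊆ {x | along D r x < 0} := by
    rintro x ⟨-, p, hp, u, hu, rfl⟩
    exact (hdec p hp u hu).trans_lt (neg_lt_zero.2 hε)
  have hopen : ∀ x ∈ F, ∀ᶠ q in 𝓝 x, v q = c → r q = 0 → q ∈ F := fun x hx =>
    eventually_mem_focalSet hD.smooth_D hrs hε hγ_zero hpos hγ' hdec hvd hvD (fun p hp => by
      obtain ⟨U, h, hU, hpU, hh, hhc, hhp, hUS, hdh⟩ :=
        hS₀_spatial.exists_transverse_function hD hS₀_subset hp
      exact ⟨U, h, hU, hpU, hh.mdifferentiableAt (by simp), hhc, hhp, hUS, hdh⟩) hx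
  have hsurj : ∀ x ∈ F, Function.Surjective (diff (fun y => (r y, v y)) x) := fun x hx => by
    obtain ⟨Z, hZ⟩ := hD.exists_diff_v_ne_zero x
    exact diff_pair_surjective hrs.contMDiffAt hD.smooth_v.contMDiffAt (X := D x) (hFD hx).ne
      (hD.diff_v_D x) hZ
  obtain ⟨N, η, hN, hND, hη, hNF, hlev⟩ := exists_levels hrs hD.smooth_v hFc hFne
    (isOpen_lt halc continuous_const) hFD hF0 hopen hsurj
  refine ⟨η, fun s => N ∩ {x | r x = 0 ∧ v x = s}, hη, ?_, fun s hs => (hlev s hs).2, ?_, ?_, ?_⟩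
  · subst hr
    exact isTrappingHorizon_levels hnabla hD t hN (fun x hx => hND hx) fun s hs => (hlev s hs).1
  · intro p hp
    obtain ⟨u, hu, hu0, huniq⟩ := hzero p hp
    -- The slice `s = c` is exactly `F`, so uniqueness of the zero is uniqueness of the
    -- intersection.
    simp only [hNF, hρr p hp]
    exact ⟨u, ⟨Set.Ioc_subset_Icc_self hu, hu0, p, hp, u, Set.Ioc_subset_Icc_self hu, rfl⟩,
      fun u' hu' => huniq u' hu'.1 hu'.2.1⟩
  · simp only [hNF]
    rintro x ⟨hx, p, hp, u, hu, rfl⟩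
    refine ⟨p, hp, u, ⟨hu.1.lt_of_ne ?_, hρr p hp ▸ hu.2⟩, rfl⟩
    rintro rfl
    rw [hγ_zero p hp] at hx
    exact (hpos p hp).ne' hx
  · intro p hp
    obtain ⟨u, hu, hu0, -⟩ := hzero p hp
    exact ⟨u, hρr p hp ▸ hu, by rw [hrho, hu0, Complex.ofReal_zero]⟩
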